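/- Call a function $h:\mathbb{R}^n\to\{\pm1\}$ a linear threshold function (LTF) if $h(x)=\mathrm{sign}(w\cdot x+\theta)$ for some $w\in\mathbb{R}^n$, $\theta\in\mathbb{R}$ (with $\mathrm{sign}(0)=1$; $w=0$ is allowed, so constants are LTFs). The indicator function of an intersection of $k$ LTFs $h_1,\dots,h_k$ is the function $f:\mathbb{R}^n\to\{0,1\}$ with $f(x)=1$ if and only if $h_i(x)=1$ for all $i$; for $k=0$ it is the constant $1$. There is an absolute constant $C>0$ such that the following holds for all integers $n\ge 0$ and $k\ge 1$ and all real $\delta$ with $0<\delta\le k/2$. Let $G\sim N(0,I_n)$, let $f:\mathbb{R}^n\to\{0,1\}$ be the indicator function of an intersection of $k$ LTFs, and let $V\subseteq\mathbb{R}^n$ be a linear subspace. Suppose that for every unit vector $v$ orthogonal to $V$ and every one-variable real polynomial $p$ of degree at most $2$ with $\mathbf{E}[p(Z)]=0$ and $\mathbf{E}[p(Z)^2]=1$ for $Z\sim N(0,1)$, one has $$\left|\mathbf{E}[f(G)\,p(v\cdot G)]\right|<\delta .$$ Then there is a function $g:\mathbb{R}^n\to\{0,1\}$, the indicator function of an intersection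 of at most $k$ LTFs, such that $g(x)=g(\pi_V(x))$ for all $x\in\mathbb{R}^n$, where $\pi_V$ is the orthogonal projection onto $V$, and $$\|f-g\|_1=\mathbf{E}\left[|f(G)-g(G)|\right]\le C\,\delta^{1/11}\,k^{15/11}\,\log^{2/11}(k/\delta).$$ -/

import Mathlib

open MeasureTheory ProbabilityTheory

/-- A linear threshold function on `ℝⁿ`: `h(x) = sign(w · x + θ)`, with values in `{±1}` and the
convention `sign(0) = 1`. Polynomials of degree at most `1` are allowed, so `w = 0` is permitted
and the two constant functions are linear threshold functions. -/
def IsLTF {n : ℕ} (h : EuclideanSpace ℝ (Fin n) → ℝ) : Prop :=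
  ∃ (w : EuclideanSpace ℝ (Fin n)) (θ : ℝ), ∀ x, h x = if 0 ≤ inner ℝ w x + θ then 1 else -1

open Classical in
/-- `f` is the `{0,1}`-valued indicator function of an intersection of `k` linear threshold
functions: there are `k` of them such that `f x = 1` if all of them equal `1` at `x`, and
`f x = 0` otherwise. -/
def IsIntersectionOfLTFs {n : ℕ} (k : ℕ) (f : EuclideanSpace ℝ (Fin n) → ℝ) : Prop :=
  ∃ h : Fin k → EuclideanSpace ℝ (Fin n) → ℝ,
    (∀ i, IsLTF (h i)) ∧ ∀ x, f x = if ∀ i, h i x = 1 then 1 else 0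

/-- A real polynomial in one variable of degree at most `2` which has mean `0` and second moment
`1` under the standard Gaussian distribution on `ℝ`. -/
def IsNormalizedMeanZeroQuadratic (p : Polynomial ℝ) : Prop :=
  p.natDegree ≤ 2 ∧ ∫ t, p.eval t ∂(gaussianReal 0 1) = 0 ∧
    ∫ t, (p.eval t) ^ 2 ∂(gaussianReal 0 1) = 1

/-!
By the Prékopa–Leindler inequality, the restriction of the Gaussian measure to a convex set `K` is
at least as log-concave as the Gaussian measure itself, and therefore satisfies its Poincaré
inequality: in particular a linear functional `⟪v, ·⟫` with `‖v‖ = 1` has variance at most `1` on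
`K`. If `K` lies in a half-space with unit normal `w`, perturbing the functional by a multiple of
`exp (-d / s)`, where `d` is the distance from the bounding hyperplane, improves this bound by about
`⟪v, w⟫ ^ 2` times the fraction of `K` within `s` of the hyperplane. The moment hypotheses make the
variance almost `1` in the directions orthogonal to `V`, so little of `K` lies near a facet whose
normal is far from `V`. The Poincaré inequality, applied to a smooth function that vanishes outside
the half-spaces of these facets and equals almost `1` deep inside them, then shows that dropping
them adds little mass. The remaining normals are close to `V` and can be replaced by their
projections. If `K` itself has small mass, the zero function is a good enough approximation.
-/

open scoped ENNReal RealInnerProductSpace symmDiff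
open Filter Topology

section BrunnMinkowski

variable {A B C : Set ℝ}

theorem volume_add_le_of_midpoint_mem_of_isCompact (hA : IsCompact A) (hB : IsCompact B)
    (hA₀ : A.Nonempty) (hB₀ : B.Nonempty) (h : ∀ a ∈ A, ∀ b ∈ B, (a + b) / 2 ∈ C) :
    volume A + volume B ≤ 2 * volume C := by
  obtain ⟨a, ha, ha_max⟩ := hA.exists_isGreatest hA₀
  obtain ⟨b, hb, hb_min⟩ := hB.exists_isLeast hB₀
  -- The translates `A + b` and `a + B` both lie in `2C` and meet only in `a + b`.
  have translates_subset :
      (· - b) ⁻¹' A ∪ (· - a) ⁻¹' B ⊆ ((2 : ℝ)⁻¹ * ·) ⁻¹' C := by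
    rintro x (hx | hx)
    · simpa [div_eq_inv_mul] using h _ hx _ hb
    · simpa [div_eq_inv_mul] using h _ ha _ hx
  have overlap_null : volume ((· - b) ⁻¹' A ∩ (· - a) ⁻¹' B) = 0 := by
    refine measure_mono_null (t := {a + b}) (fun x ⟨hxA, hxB⟩ ↦ ?_) (by simp)
    have := ha_max hxA
    have := hb_min hxB
    rw [Set.mem_singleton_iff]
    linarith
  calc volume A + volume B
      = volume ((· - b) ⁻¹' A) + volume ((· - a) ⁻¹' B) := by
        simp only [sub_eq_add_neg, measure_preimage_add_right]
    _ = volume ((· - b) ⁻¹' A ∪ (· - a) ⁻¹' B) :=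
        (measure_union₀' (hA.measurableSet.preimage (by fun_prop)).nullMeasurableSet
          overlap_null).symm
    _ ≤ volume (((2 : ℝ)⁻¹ * ·) ⁻¹' C) := measure_mono translates_subset
    _ = 2 * volume C := by rw [Real.volume_preimage_mul_left (by norm_num)]; simp

theorem volume_add_le_of_midpoint_mem (hA : MeasurableSet A) (hB : MeasurableSet B)
    (hA₀ : A.Nonempty) (hB₀ : B.Nonempty) (h : ∀ a ∈ A, ∀ b ∈ B, (a + b) / 2 ∈ C) :
    volume A + volume B ≤ 2 * volume C := by
  obtain ⟨a, ha⟩ := hA₀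
  obtain ⟨b, hb⟩ := hB₀
  rw [hA.measure_eq_iSup_isCompact, hB.measure_eq_iSup_isCompact]
  simp only [iSup_and']
  refine ENNReal.biSup_add_biSup_le' ⟨∅, by simp⟩ ⟨∅, by simp⟩ fun K hK L hL ↦ ?_
  calc volume K + volume L ≤ volume (insert a K) + volume (insert b L) := by
        gcongr <;> exact Set.subset_insert _ _
    _ ≤ 2 * volume C :=
        volume_add_le_of_midpoint_mem_of_isCompact (hK.2.insert a) (hL.2.insert b)
          (Set.insert_nonempty _ _) (Set.insert_nonempty _ _) fun x hx y hy ↦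
          h x (Set.insert_subset ha hK.1 hx) y (Set.insert_subset hb hL.1 hy)

end BrunnMinkowski

section LogConcaveMeasures

variable {X Y : Type*} [AddCommGroup X] [MeasurableSpace X] [AddCommGroup Y] [MeasurableSpace Y]

/-- A measure is log-concave with modulus `q` if it satisfies the midpoint Prékopa–Leindler
inequality, improved by the factor `exp (-q d)` at a pair of points `z + d`, `z - d`. For a density
`exp (-U)` on a Euclidean space this expresses `U (z + d) + U (z - d) ≥ 2 * U z + q d`. -/
def LogConcaveWith (q : X → ℝ) (μ : Measure X) : Prop :=
  ∀ ⦃u v w : X → ℝ≥0∞⦄, Measurable u → Measurable v → Measurable w →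
    (∀ z d, u (z + d) * v (z - d) * ENNReal.ofReal (Real.exp (-q d)) ≤ w z ^ 2) →
    (∫⁻ x, u x ∂μ) * (∫⁻ x, v x ∂μ) ≤ (∫⁻ x, w x ∂μ) ^ 2

theorem lintegral_eq_lintegral_measure_ofReal_lt {Ω : Type*} [MeasurableSpace Ω] (μ : Measure Ω)
    {f : Ω → ℝ≥0∞} (hf : Measurable f) (hf_top : ∀ x, f x ≠ ∞) :
    ∫⁻ x, f x ∂μ = ∫⁻ t in Set.Ioi 0, μ {x | ENNReal.ofReal t < f x} := by
  calc ∫⁻ x, f x ∂μ = ∫⁻ x, ENNReal.ofReal (f x).toReal ∂μ := by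
        simp only [ENNReal.ofReal_toReal (hf_top _)]
    _ = ∫⁻ t in Set.Ioi 0, μ {x | t < (f x).toReal} :=
        lintegral_eq_lintegral_meas_lt μ (ae_of_all _ fun _ ↦ ENNReal.toReal_nonneg)
          hf.ennreal_toReal.aemeasurable
    _ = ∫⁻ t in Set.Ioi 0, μ {x | ENNReal.ofReal t < f x} :=
        setLIntegral_congr_fun measurableSet_Ioi fun t ht ↦ by
          simp only [ENNReal.ofReal_lt_iff_lt_toReal (le_of_lt ht) (hf_top _)]

theorem lintegral_add_lintegral_le_of_iSup_eq_one {u v w : ℝ → ℝ≥0∞} (hu : Measurable u)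
    (hv : Measurable v) (hw : Measurable w) (hu_sup : ⨆ x, u x = 1) (hv_sup : ⨆ x, v x = 1)
    (h : ∀ x y, u x * v y ≤ w ((x + y) / 2) ^ 2) :
    (∫⁻ x, u x) + ∫⁻ x, v x ≤ 2 * ∫⁻ x, w x := by
  wlog hw_le : ∀ x, w x ≤ 1 generalizing w
  · refine (this (hw.min measurable_const) (fun x y ↦ ?_) fun x ↦ min_le_right (w x) 1).trans ?_
    · rcases min_choice (w ((x + y) / 2)) 1 with hmin | hmin <;> rw [hmin]
      · exact h x y
      · exact (mul_le_mul' (hu_sup ▸ le_iSup u x) (hv_sup ▸ le_iSup v y)).trans (by simp)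
    · gcongr
      exact min_le_left _ _
  have ne_top {f : ℝ → ℝ≥0∞} (hf : ∀ x, f x ≤ 1) (x : ℝ) : f x ≠ ∞ :=
    ne_top_of_le_ne_top ENNReal.one_ne_top (hf x)
  rw [lintegral_eq_lintegral_measure_ofReal_lt _ hu (ne_top fun x ↦ hu_sup ▸ le_iSup u x),
    lintegral_eq_lintegral_measure_ofReal_lt _ hv (ne_top fun x ↦ hv_sup ▸ le_iSup v x),
    lintegral_eq_lintegral_measure_ofReal_lt _ hw (ne_top hw_le),
    ← lintegral_const_mul' _ _ ENNReal.ofNat_ne_top, ← lintegral_add_left]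
  · refine lintegral_mono fun t ↦ ?_
    rcases lt_or_ge (ENNReal.ofReal t) 1 with ht | ht
    · refine volume_add_le_of_midpoint_mem (hu measurableSet_Ioi) (hv measurableSet_Ioi)
        (lt_iSup_iff.1 (hu_sup ▸ ht :)) (lt_iSup_iff.1 (hv_sup ▸ ht :)) fun a ha b hb ↦ ?_
      refine lt_of_pow_lt_pow_left' 2 (lt_of_lt_of_le ?_ (h a b))
      exact sq (ENNReal.ofReal t) ▸ ENNReal.mul_lt_mul ha hb
    · have superlevel_empty {f : ℝ → ℝ≥0∞} (hf : ⨆ x, f x = 1) :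
          {x | ENNReal.ofReal t < f x} = ∅ :=
        Set.eq_empty_of_forall_notMem fun x hx ↦ (hx.trans_le (hf ▸ le_iSup f x)).not_ge ht
      simp [superlevel_empty hu_sup, superlevel_empty hv_sup]
  · exact Antitone.measurable fun s t hst ↦ measure_mono fun a ha ↦
      (ENNReal.ofReal_le_ofReal hst).trans_lt ha

theorem four_mul_mul_le_add_sq (x y : ℝ≥0∞) : 4 * (x * y) ≤ (x + y) ^ 2 := by
  rcases eq_or_ne x ∞ with rfl | hx
  · simp
  rcases eq_or_ne y ∞ with rfl | hy
  · simp
  lift x to NNReal using hx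
  lift y to NNReal using hy
  exact_mod_cast (mul_assoc 4 x y).symm.trans_le (four_mul_le_sq_add x y)

theorem lintegral_mul_lintegral_le_sq_of_bounded {u v w : ℝ → ℝ≥0∞} (hu : Measurable u)
    (hv : Measurable v) (hw : Measurable w) (hu_top : ⨆ x, u x ≠ ∞) (hv_top : ⨆ x, v x ≠ ∞)
    (h : ∀ x y, u x * v y ≤ w ((x + y) / 2) ^ 2) :
    (∫⁻ x, u x) * (∫⁻ x, v x) ≤ (∫⁻ x, w x) ^ 2 := by
  set a := ⨆ x, u x with ha
  set b := ⨆ x, v x with hb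
  rcases eq_or_ne a 0 with ha₀ | ha₀
  · simp [ENNReal.iSup_eq_zero.1 (ha.symm.trans ha₀)]
  rcases eq_or_ne b 0 with hb₀ | hb₀
  · simp [ENNReal.iSup_eq_zero.1 (hb.symm.trans hb₀)]
  set c := ((a * b)⁻¹) ^ (2⁻¹ : ℝ)
  have hc : c ^ 2 = a⁻¹ * b⁻¹ := by
    rw [← ENNReal.rpow_natCast, ← ENNReal.rpow_mul, ENNReal.mul_inv (.inl ha₀) (.inl hu_top)]
    norm_num
  have normalized := lintegral_add_lintegral_le_of_iSup_eq_one (hu.const_mul a⁻¹)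
    (hv.const_mul b⁻¹) (hw.const_mul c)
    (by rw [← ENNReal.mul_iSup, ENNReal.inv_mul_cancel ha₀ hu_top])
    (by rw [← ENNReal.mul_iSup, ENNReal.inv_mul_cancel hb₀ hv_top])
    (fun x y ↦ by
      rw [mul_mul_mul_comm, mul_pow, hc]
      gcongr
      exact h x y)
  rw [lintegral_const_mul _ hu, lintegral_const_mul _ hv, lintegral_const_mul _ hw] at normalized
  generalize ∫⁻ x, u x = U, ∫⁻ x, v x = V, ∫⁻ x, w x = W at *
  have amgm : 4 * (a⁻¹ * b⁻¹ * (U * V)) ≤ 4 * (a⁻¹ * b⁻¹ * W ^ 2) :=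
    calc 4 * (a⁻¹ * b⁻¹ * (U * V)) = 4 * ((a⁻¹ * U) * (b⁻¹ * V)) := by ring
      _ ≤ (a⁻¹ * U + b⁻¹ * V) ^ 2 := four_mul_mul_le_add_sq _ _
      _ ≤ (2 * (c * W)) ^ 2 := by gcongr
      _ = 4 * (c ^ 2 * W ^ 2) := by ring
      _ = 4 * (a⁻¹ * b⁻¹ * W ^ 2) := by rw [hc]
  rw [ENNReal.mul_le_mul_iff_right (by simp) (by simp),
    ENNReal.mul_le_mul_iff_right (by simp [hu_top, hv_top]) (ENNReal.mul_ne_top (by simpa)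
      (by simpa))] at amgm
  exact amgm

theorem logConcaveWith_zero_volume_real : LogConcaveWith 0 (volume : Measure ℝ) := by
  intro u v w hu hv hw h
  have lintegral_eq_iSup_min {f : ℝ → ℝ≥0∞} (hf : Measurable f) :
      ∫⁻ x, f x = ⨆ N : ℕ, ∫⁻ x, min (f x) N := by
    rw [← lintegral_iSup (fun N ↦ hf.min measurable_const) fun N M hNM x ↦
      min_le_min_left _ (by exact_mod_cast hNM)]
    simp only [← inf_iSup_eq, ENNReal.iSup_natCast, inf_top_eq]
  have iSup_min_ne_top (f : ℝ → ℝ≥0∞) (N : ℕ) : ⨆ x, min (f x) (N : ℝ≥0∞) ≠ ∞ :=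
    ne_top_of_le_ne_top (ENNReal.natCast_ne_top N) (iSup_le fun _ ↦ min_le_right _ _)
  rw [lintegral_eq_iSup_min hu, lintegral_eq_iSup_min hv]
  simp only [ENNReal.iSup_mul, ENNReal.mul_iSup]
  refine iSup_le fun N ↦ iSup_le fun M ↦ ?_
  refine lintegral_mul_lintegral_le_sq_of_bounded (hu.min measurable_const)
    (hv.min measurable_const) hw (iSup_min_ne_top u _) (iSup_min_ne_top v _) fun x y ↦ ?_
  have := h ((x + y) / 2) ((x - y) / 2)
  rw [show (x + y) / 2 + (x - y) / 2 = x by ring, show (x + y) / 2 - (x - y) / 2 = y by ring,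
    Pi.zero_apply, neg_zero, Real.exp_zero, ENNReal.ofReal_one, mul_one] at this
  exact (mul_le_mul' (min_le_left _ _) (min_le_left _ _)).trans this

theorem LogConcaveWith.withDensity {q r : X → ℝ} {μ : Measure X} (hμ : LogConcaveWith q μ)
    {ρ : X → ℝ≥0∞} (hρ : Measurable ρ)
    (h : ∀ z d, ρ (z + d) * ρ (z - d) ≤ ρ z ^ 2 * ENNReal.ofReal (Real.exp (-r d))) :
    LogConcaveWith (q + r) (μ.withDensity ρ) := by
  intro u v w hu hv hw huvw
  simp only [lintegral_withDensity_eq_lintegral_mul _ hρ, hu, hv, hw]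
  refine hμ (hρ.mul hu) (hρ.mul hv) (hρ.mul hw) fun z d ↦ ?_
  have exp_split : ENNReal.ofReal (Real.exp (-(q + r) d)) =
      ENNReal.ofReal (Real.exp (-r d)) * ENNReal.ofReal (Real.exp (-q d)) := by
    rw [← ENNReal.ofReal_mul (Real.exp_nonneg _), ← Real.exp_add, Pi.add_apply]
    ring_nf
  calc ρ (z + d) * u (z + d) * (ρ (z - d) * v (z - d)) * ENNReal.ofReal (Real.exp (-q d))
      = ρ (z + d) * ρ (z - d) * (u (z + d) * v (z - d) * ENNReal.ofReal (Real.exp (-q d))) := by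
        ring
    _ ≤ ρ z ^ 2 * ENNReal.ofReal (Real.exp (-r d)) *
          (u (z + d) * v (z - d) * ENNReal.ofReal (Real.exp (-q d))) := by
        gcongr ?_ * _; exact h z d
    _ = ρ z ^ 2 * (u (z + d) * v (z - d) * ENNReal.ofReal (Real.exp (-(q + r) d))) := by
        rw [exp_split]; ring
    _ ≤ ρ z ^ 2 * w z ^ 2 := by gcongr; exact huvw z d
    _ = (ρ z * w z) ^ 2 := (mul_pow _ _ 2).symm

theorem LogConcaveWith.const_smul {q : X → ℝ} {μ : Measure X} (hμ : LogConcaveWith q μ)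
    (c : ℝ≥0∞) : LogConcaveWith q (c • μ) := by
  rw [← withDensity_const]
  simpa using hμ.withDensity (r := 0) measurable_const fun _ _ ↦ by simp [sq]

theorem LogConcaveWith.restrict {q : X → ℝ} {μ : Measure X} (hμ : LogConcaveWith q μ)
    {K : Set X} (hK : MeasurableSet K)
    (hK_mid : ∀ z d, z + d ∈ K → z - d ∈ K → z ∈ K) : LogConcaveWith q (μ.restrict K) := by
  rw [← withDensity_indicator_one hK]
  simpa using hμ.withDensity (r := 0) (measurable_one.indicator hK) fun z d ↦ by
    by_cases h_add : z + d ∈ K <;> by_cases h_sub : z - d ∈ K <;> simp [h_add, h_sub]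
    simp [hK_mid z d h_add h_sub]

theorem LogConcaveWith.prod {q : X → ℝ} {r : Y → ℝ} {μ : Measure X} {ν : Measure Y} [SFinite ν]
    (hμ : LogConcaveWith q μ) (hν : LogConcaveWith r ν) :
    LogConcaveWith (fun d : X × Y ↦ q d.1 + r d.2) (μ.prod ν) := by
  intro u v w hu hv hw h
  simp only [lintegral_prod _ hu.aemeasurable, lintegral_prod _ hv.aemeasurable,
    lintegral_prod _ hw.aemeasurable]
  refine hμ hu.lintegral_prod_right' hv.lintegral_prod_right' hw.lintegral_prod_right'
    fun z d ↦ ?_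
  have hv_section : Measurable fun y ↦ v (z - d, y) := hv.comp measurable_prodMk_left
  rw [mul_assoc, ← lintegral_mul_const _ hv_section]
  refine hν (hu.comp measurable_prodMk_left)
    (hv_section.mul_const _) (hw.comp measurable_prodMk_left) fun z' d' ↦ ?_
  have := h (z, z') (d, d')
  rw [neg_add, Real.exp_add, ENNReal.ofReal_mul (Real.exp_nonneg _), ← mul_assoc] at this
  simpa only [Prod.mk_add_mk, Prod.mk_sub_mk, mul_assoc] using this

theorem LogConcaveWith.map {q : X → ℝ} {r : Y → ℝ} {μ : Measure X} (hμ : LogConcaveWith q μ)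
    {F : Type*} [FunLike F X Y] [AddMonoidHomClass F X Y] {e : F} (he : Measurable e)
    (hqr : ∀ d, r (e d) ≤ q d) : LogConcaveWith r (μ.map e) := by
  intro u v w hu hv hw h
  rw [lintegral_map hu he, lintegral_map hv he, lintegral_map hw he]
  refine hμ (hu.comp he) (hv.comp he) (hw.comp he) fun z d ↦ le_trans ?_ (h (e z) (e d))
  simp only [map_add, map_sub]
  gcongr
  exact hqr d

theorem LogConcaveWith.pi {n : ℕ} {q : ℝ → ℝ} {μ : Measure ℝ} [SigmaFinite μ]
    (hμ : LogConcaveWith q μ) :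
    LogConcaveWith (fun d : Fin n → ℝ ↦ ∑ i, q (d i)) (Measure.pi fun _ ↦ μ) := by
  induction n with
  | zero =>
    intro u v w _ _ _ h
    simp only [lintegral_unique, Measure.pi_univ, Finset.univ_eq_empty, Finset.prod_empty, mul_one]
    have := h default default
    simp only [Finset.univ_eq_empty, Finset.sum_empty, neg_zero, Real.exp_zero,
      ENNReal.ofReal_one, mul_one] at this
    convert this
  | succ n ih =>
    have cons_eq : ⇑(Fin.consLinearEquiv ℝ fun _ : Fin (n + 1) ↦ ℝ) =
        (MeasurableEquiv.piFinSuccAbove (fun _ ↦ ℝ) 0).symm := by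
      ext p i
      simp [MeasurableEquiv.piFinSuccAbove, Fin.insertNthEquiv]
    rw [← ((measurePreserving_piFinSuccAbove (fun _ : Fin (n + 1) ↦ μ) 0).symm _).map_eq, ← cons_eq]
    refine (hμ.prod ih).map (cons_eq ▸ MeasurableEquiv.measurable _) fun d ↦ le_of_eq ?_
    simp [Fin.sum_univ_succ]

theorem logConcaveWith_gaussianReal : LogConcaveWith (fun d ↦ d ^ 2) (gaussianReal 0 1) := by
  rw [gaussianReal_of_var_ne_zero _ one_ne_zero]
  refine (zero_add (fun d : ℝ ↦ d ^ 2)) ▸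
    logConcaveWith_zero_volume_real.withDensity (measurable_gaussianPDF 0 1) fun z d ↦ le_of_eq ?_
  simp only [gaussianPDF, gaussianPDFReal]
  rw [← ENNReal.ofReal_mul (by positivity), ← ENNReal.ofReal_pow (by positivity),
    ← ENNReal.ofReal_mul (by positivity), mul_pow, ← Real.exp_nat_mul, mul_mul_mul_comm,
    ← Real.exp_add, mul_assoc (_ ^ 2), ← Real.exp_add, sq (Real.sqrt _)⁻¹]
  congr 3
  push_cast
  ring

end LogConcaveMeasures

section StdGaussian

variable {E : Type*} [NormedAddCommGroup E] [InnerProductSpace ℝ E] [FiniteDimensional ℝ E]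
  [MeasurableSpace E] [BorelSpace E]

theorem logConcaveWith_stdGaussian : LogConcaveWith (fun d ↦ ‖d‖ ^ 2) (stdGaussian E) := by
  rw [stdGaussian, ← funext (Fintype.linearCombination_apply ℝ (stdOrthonormalBasis ℝ E))]
  refine logConcaveWith_gaussianReal.pi.map ?_ fun d ↦ le_of_eq ?_
  · exact (LinearMap.continuous_of_finiteDimensional _).measurable
  · rw [← (stdOrthonormalBasis ℝ E).sum_sq_inner_right]
    simp [Fintype.linearCombination_apply,
      (stdOrthonormalBasis ℝ E).orthonormal.inner_right_fintype]

end StdGaussian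

section Poincare

theorem two_add_sq_le_exp_add_exp_neg (x : ℝ) : 2 + x ^ 2 ≤ Real.exp x + Real.exp (-x) := by
  have sq_half_le : (x / 2) ^ 2 ≤ Real.sinh (x / 2) ^ 2 :=
    sq_le_sq.2 (Real.abs_sinh (x / 2) ▸ Real.self_le_sinh_iff.2 (abs_nonneg _))
  have exp_add_exp_neg : Real.exp x + Real.exp (-x) = 2 * Real.cosh x := by
    rw [Real.cosh_eq]
    ring
  have cosh_eq : Real.cosh x = 1 + 2 * Real.sinh (x / 2) ^ 2 := by
    rw [show Real.cosh x = Real.cosh (2 * (x / 2)) by ring_nf, Real.cosh_two_mul, Real.cosh_sq]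
    ring
  linarith

theorem one_add_sq_mul_variance_le_mgf_mul_mgf_neg {Ω : Type*} [MeasurableSpace Ω] {μ : Measure Ω}
    [IsProbabilityMeasure μ] {X : Ω → ℝ} (hX : MemLp X 2 μ) {t : ℝ}
    (h_pos : Integrable (fun ω ↦ Real.exp (t * X ω)) μ)
    (h_neg : Integrable (fun ω ↦ Real.exp (-t * X ω)) μ) :
    1 + t ^ 2 * Var[X; μ] ≤ mgf X μ t * mgf X μ (-t) := by
  set m := μ[X]
  have hX₁ : Integrable X μ := hX.integrable one_le_two
  have hX₂ : Integrable (fun ω ↦ (X ω - m) ^ 2) μ := (hX.sub (memLp_const m)).integrable_sq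
  have exp_centered (s : ℝ) : (fun ω ↦ Real.exp (s * (X ω - m))) =
      fun ω ↦ Real.exp (s * X ω) * Real.exp (-(s * m)) := by
    ext ω
    rw [← Real.exp_add]
    ring_nf
  have integrable_centered {s : ℝ} (hs : Integrable (fun ω ↦ Real.exp (s * X ω)) μ) :
      Integrable (fun ω ↦ Real.exp (s * (X ω - m))) μ := exp_centered s ▸ hs.mul_const _
  set P : ℝ → ℝ := fun s ↦ ∫ ω, Real.exp (s * (X ω - m)) ∂μ with hP
  have mgf_eq (s : ℝ) : mgf X μ s * Real.exp (-(s * m)) = P s := by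
    simp only [hP, exp_centered, integral_mul_const, mgf]
  have one_le {s : ℝ} (hs : Integrable (fun ω ↦ Real.exp (s * X ω)) μ) : 1 ≤ P s :=
    calc (1 : ℝ) = ∫ ω, (s * (X ω - m) + 1) ∂μ := by
          rw [integral_add (by fun_prop) (by fun_prop), integral_const_mul,
            integral_sub hX₁ (by fun_prop)]
          simp [m]
      _ ≤ P s := integral_mono (by fun_prop) (integrable_centered hs) fun ω ↦ Real.add_one_le_exp _
  have two_add_le : 2 + t ^ 2 * Var[X; μ] ≤ P t + P (-t) :=
    calc 2 + t ^ 2 * Var[X; μ] = ∫ ω, (2 + t ^ 2 * (X ω - m) ^ 2) ∂μ := by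
          rw [integral_add (by fun_prop) (by fun_prop), integral_const_mul,
            variance_eq_integral hX₁.aemeasurable]
          simp [m]
      _ ≤ ∫ ω, (Real.exp (t * (X ω - m)) + Real.exp (-t * (X ω - m))) ∂μ := by
          refine integral_mono (by fun_prop)
            ((integrable_centered h_pos).add (integrable_centered h_neg)) fun ω ↦ ?_
          simpa only [mul_pow, neg_mul] using two_add_sq_le_exp_add_exp_neg (t * (X ω - m))
      _ = P t + P (-t) := integral_add (integrable_centered h_pos) (integrable_centered h_neg)
  calc 1 + t ^ 2 * Var[X; μ] ≤ P t * P (-t) := by nlinarith [one_le h_pos, one_le h_neg]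
    _ = mgf X μ t * mgf X μ (-t) := by
      rw [← mgf_eq, ← mgf_eq, mul_mul_mul_comm, ← Real.exp_add]
      simp

variable {E : Type*} [NormedAddCommGroup E]

/-- `G` bounds the size of the gradient of `h` on `K`, in an integrated form: the increment of `h`
over a segment of `K` with midpoint `z` and half-length `‖d‖` is at most `2 * G z * ‖d‖`, up to an
error that is uniformly of second order. -/
def HasMidpointGradientBoundOn (h G : E → ℝ) (K : Set E) : Prop :=
  ∃ M, ∀ z d, z + d ∈ K → z - d ∈ K → h (z + d) - h (z - d) ≤ 2 * G z * ‖d‖ + M * ‖d‖ ^ 2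

variable [MeasurableSpace E] {ν : Measure E}

theorem LogConcaveWith.lintegral_exp_mul_lintegral_exp_neg_le
    (hν : LogConcaveWith (fun d ↦ ‖d‖ ^ 2) ν) {K : Set E} (hK : MeasurableSet K)
    (hνK : ∀ᵐ x ∂ν, x ∈ K) {h G : E → ℝ} (hh : Measurable h) (hG : Measurable G) {M ε : ℝ}
    (hM : ∀ z d, z + d ∈ K → z - d ∈ K → h (z + d) - h (z - d) ≤ 2 * G z * ‖d‖ + M * ‖d‖ ^ 2)
    (hε : 0 ≤ ε) (hεM : ε * M < 1) :
    (∫⁻ x, ENNReal.ofReal (Real.exp (ε * h x)) ∂ν) *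
        (∫⁻ x, ENNReal.ofReal (Real.exp (-ε * h x)) ∂ν) ≤
      (∫⁻ x, ENNReal.ofReal (Real.exp (ε ^ 2 / (1 - ε * M) * G x ^ 2 / 2)) ∂ν) ^ 2 := by
  set e : ℝ → E → ℝ≥0∞ := fun s ↦ K.indicator fun x ↦ ENNReal.ofReal (Real.exp (s * h x)) with he
  have lintegral_e (s : ℝ) : ∫⁻ x, ENNReal.ofReal (Real.exp (s * h x)) ∂ν = ∫⁻ x, e s x ∂ν :=
    lintegral_congr_ae <| hνK.mono fun x hx ↦ by simp only [he, Set.indicator_of_mem hx]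
  have measurable_e (s : ℝ) : Measurable (e s) := by fun_prop
  rw [lintegral_e, lintegral_e]
  refine hν (measurable_e ε) (measurable_e (-ε)) (by fun_prop) fun z d ↦ ?_
  by_cases h_add : z + d ∈ K; swap
  · simp [he, h_add]
  by_cases h_sub : z - d ∈ K; swap
  · simp [he, h_sub]
  simp only [he, Set.indicator_of_mem h_add, Set.indicator_of_mem h_sub]
  rw [← ENNReal.ofReal_mul (Real.exp_nonneg _), ← ENNReal.ofReal_mul (by positivity),
    ← ENNReal.ofReal_pow (Real.exp_nonneg _), ← Real.exp_add, ← Real.exp_add, ← Real.exp_nat_mul]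
  gcongr
  have h_pos : 0 < 1 - ε * M := sub_pos.2 hεM
  have complete_square : 2 * (ε * G z) * ‖d‖ - (1 - ε * M) * ‖d‖ ^ 2 ≤
      (ε * G z) ^ 2 / (1 - ε * M) := by
    rw [le_div_iff₀ h_pos]
    nlinarith [sq_nonneg (ε * G z - (1 - ε * M) * ‖d‖)]
  calc ε * h (z + d) + -ε * h (z - d) + -‖d‖ ^ 2
      = ε * (h (z + d) - h (z - d)) - ‖d‖ ^ 2 := by ring
    _ ≤ ε * (2 * G z * ‖d‖ + M * ‖d‖ ^ 2) - ‖d‖ ^ 2 := by gcongr; exact hM z d h_add h_sub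
    _ = 2 * (ε * G z) * ‖d‖ - (1 - ε * M) * ‖d‖ ^ 2 := by ring
    _ ≤ (ε * G z) ^ 2 / (1 - ε * M) := complete_square
    _ = (2 : ℕ) * (ε ^ 2 / (1 - ε * M) * G z ^ 2 / 2) := by push_cast; ring

theorem integrable_of_lintegral_ofReal_mul_ne_top {Ω : Type*} [MeasurableSpace Ω] {μ : Measure Ω}
    [NeZero μ] {f g : Ω → ℝ} (hf : Measurable f) (hf_nonneg : 0 ≤ f) (hg : Measurable g)
    (hg_pos : ∀ x, 0 < g x)
    (h : (∫⁻ x, ENNReal.ofReal (f x) ∂μ) * (∫⁻ x, ENNReal.ofReal (g x) ∂μ) ≠ ∞) :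
    Integrable f μ := by
  refine (lintegral_ofReal_ne_top_iff_integrable hf.aestronglyMeasurable (ae_of_all _ hf_nonneg)).1
    fun hf_top ↦ h ?_
  have hg_ne_zero : ∫⁻ x, ENNReal.ofReal (g x) ∂μ ≠ 0 := fun hg_zero ↦ by
    obtain ⟨x, hx⟩ := ((lintegral_eq_zero_iff hg.ennreal_ofReal).1 hg_zero).exists
    exact (hg_pos x).not_ge (ENNReal.ofReal_eq_zero.1 hx)
  rw [hf_top, ENNReal.top_mul hg_ne_zero]

theorem integral_exp_le_one_add {Ω : Type*} [MeasurableSpace Ω] {μ : Measure Ω}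
    [IsProbabilityMeasure μ] {f : Ω → ℝ} (hf : Integrable f μ) {c : ℝ}
    (hf_nonneg : ∀ x, 0 ≤ f x) (hfc : ∀ x, f x ≤ c) :
    ∫ x, Real.exp (f x) ∂μ ≤ 1 + Real.exp c * ∫ x, f x ∂μ := by
  have exp_le (x : Ω) : Real.exp (f x) ≤ 1 + Real.exp c * f x := by
    have : (1 - f x) * Real.exp (f x) ≤ 1 := by
      calc (1 - f x) * Real.exp (f x) ≤ Real.exp (-f x) * Real.exp (f x) := by
            gcongr
            exact Real.one_sub_le_exp_neg _
        _ = 1 := by rw [← Real.exp_add, neg_add_cancel, Real.exp_zero]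
    nlinarith [Real.exp_le_exp.2 (hfc x), hf_nonneg x]
  calc ∫ x, Real.exp (f x) ∂μ ≤ ∫ x, (1 + Real.exp c * f x) ∂μ :=
        integral_mono_of_nonneg (ae_of_all _ fun _ ↦ Real.exp_nonneg _) (by fun_prop)
          (ae_of_all _ exp_le)
    _ = 1 + Real.exp c * ∫ x, f x ∂μ := by
        rw [integral_add (by fun_prop) (by fun_prop), integral_const_mul]
        simp

theorem LogConcaveWith.mgf_mul_mgf_neg_le [IsProbabilityMeasure ν]
    (hν : LogConcaveWith (fun d ↦ ‖d‖ ^ 2) ν) {K : Set E} (hK : MeasurableSet K)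
    (hνK : ∀ᵐ x ∂ν, x ∈ K) {h G : E → ℝ} (hh : Measurable h) (hG : Measurable G) {M ε A : ℝ}
    (hM : ∀ z d, z + d ∈ K → z - d ∈ K → h (z + d) - h (z - d) ≤ 2 * G z * ‖d‖ + M * ‖d‖ ^ 2)
    (hε : 0 ≤ ε) (hεM : ε * M < 1) (hGA : ∀ x, G x ^ 2 ≤ A) :
    Integrable (fun x ↦ Real.exp (ε * h x)) ν ∧ Integrable (fun x ↦ Real.exp (-ε * h x)) ν ∧
      mgf h ν ε * mgf h ν (-ε) ≤
        (∫ x, Real.exp (ε ^ 2 / (1 - ε * M) * G x ^ 2 / 2) ∂ν) ^ 2 := by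
  have : 0 < 1 - ε * M := sub_pos.2 hεM
  have integrable_exp_G : Integrable (fun x ↦ Real.exp (ε ^ 2 / (1 - ε * M) * G x ^ 2 / 2)) ν := by
    refine .of_bound (by fun_prop) (Real.exp (ε ^ 2 / (1 - ε * M) * A / 2)) (ae_of_all _ fun x ↦ ?_)
    rw [Real.norm_of_nonneg (Real.exp_nonneg _)]
    gcongr
    exact hGA x
  have exp_bound := hν.lintegral_exp_mul_lintegral_exp_neg_le hK hνK hh hG hM hε hεM
  rw [← ofReal_integral_eq_lintegral_ofReal integrable_exp_G
    (ae_of_all _ fun _ ↦ Real.exp_nonneg _)] at exp_bound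
  have product_ne_top := ne_top_of_le_ne_top (ENNReal.pow_ne_top ENNReal.ofReal_ne_top) exp_bound
  have integrable_pos : Integrable (fun x ↦ Real.exp (ε * h x)) ν :=
    integrable_of_lintegral_ofReal_mul_ne_top (by fun_prop) (fun _ ↦ Real.exp_nonneg _)
      (by fun_prop) (fun _ ↦ Real.exp_pos _) product_ne_top
  have integrable_neg : Integrable (fun x ↦ Real.exp (-ε * h x)) ν :=
    integrable_of_lintegral_ofReal_mul_ne_top (by fun_prop) (fun _ ↦ Real.exp_nonneg _)
      (by fun_prop) (fun _ ↦ Real.exp_pos _) (mul_comm (lintegral ν _) _ ▸ product_ne_top)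
  refine ⟨integrable_pos, integrable_neg, ?_⟩
  rw [← ofReal_integral_eq_lintegral_ofReal integrable_pos (ae_of_all _ fun _ ↦ Real.exp_nonneg _),
    ← ofReal_integral_eq_lintegral_ofReal integrable_neg (ae_of_all _ fun _ ↦ Real.exp_nonneg _),
    ← ENNReal.ofReal_mul (by positivity), ← ENNReal.ofReal_pow (by positivity),
    ENNReal.ofReal_le_ofReal_iff (by positivity)] at exp_bound
  exact exp_bound

theorem LogConcaveWith.one_add_sq_mul_variance_le [IsProbabilityMeasure ν]
    (hν : LogConcaveWith (fun d ↦ ‖d‖ ^ 2) ν) {K : Set E} (hK : MeasurableSet K)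
    (hνK : ∀ᵐ x ∂ν, x ∈ K) {h G : E → ℝ} (hh : Measurable h) (hG : Measurable G) {M ε A : ℝ}
    (hM : ∀ z d, z + d ∈ K → z - d ∈ K → h (z + d) - h (z - d) ≤ 2 * G z * ‖d‖ + M * ‖d‖ ^ 2)
    (hε : 0 < ε) (hεM : ε * M < 1) (hGA : ∀ x, G x ^ 2 ≤ A) :
    1 + ε ^ 2 * Var[h; ν] ≤ (1 + Real.exp (ε ^ 2 / (1 - ε * M) * A / 2) *
      (ε ^ 2 / (1 - ε * M) * (∫ x, G x ^ 2 ∂ν) / 2)) ^ 2 := by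
  have : 0 < 1 - ε * M := sub_pos.2 hεM
  obtain ⟨integrable_pos, integrable_neg, mgf_le⟩ :=
    hν.mgf_mul_mgf_neg_le hK hνK hh hG hM hε.le hεM hGA
  have zero_mem_interior : 0 ∈ interior (integrableExpSet h ν) :=
    interior_mono (convex_integrableExpSet.ordConnected.out integrable_neg integrable_pos)
      (by simpa using hε)
  have integrable_G_sq : Integrable (fun x ↦ G x ^ 2) ν :=
    .of_bound (by fun_prop) A (ae_of_all _ fun x ↦ by simpa using hGA x)
  calc 1 + ε ^ 2 * Var[h; ν] ≤ mgf h ν ε * mgf h ν (-ε) :=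
        one_add_sq_mul_variance_le_mgf_mul_mgf_neg
          (memLp_of_mem_interior_integrableExpSet zero_mem_interior 2) integrable_pos integrable_neg
    _ ≤ (∫ x, Real.exp (ε ^ 2 / (1 - ε * M) * G x ^ 2 / 2) ∂ν) ^ 2 := mgf_le
    _ ≤ (1 + Real.exp (ε ^ 2 / (1 - ε * M) * A / 2) *
          ∫ x, ε ^ 2 / (1 - ε * M) * G x ^ 2 / 2 ∂ν) ^ 2 := by
        gcongr
        refine integral_exp_le_one_add (by fun_prop) (fun x ↦ by positivity) fun x ↦ ?_
        gcongr
        exact hGA x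
    _ = _ := by rw [integral_div, integral_const_mul]

theorem LogConcaveWith.variance_le_integral_sq [IsProbabilityMeasure ν]
    (hν : LogConcaveWith (fun d ↦ ‖d‖ ^ 2) ν) {K : Set E} (hK : MeasurableSet K)
    (hνK : ∀ᵐ x ∂ν, x ∈ K) {h G : E → ℝ} (hh : Measurable h) (hG : Measurable G)
    (hhG : HasMidpointGradientBoundOn h G K) {A : ℝ} (hGA : ∀ x, G x ^ 2 ≤ A) :
    Var[h; ν] ≤ ∫ x, G x ^ 2 ∂ν := by
  obtain ⟨M, hM⟩ := hhG
  set J := ∫ x, G x ^ 2 ∂ν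
  set r : ℝ → ℝ := fun ε ↦ Real.exp (ε ^ 2 / (1 - ε * M) * A / 2) / (1 - ε * M)
  have hr : ContinuousAt r 0 := by
    have : (1 : ℝ) - 0 * M ≠ 0 := by simp
    fun_prop (disch := assumption)
  have tendsto_bound : Tendsto (fun ε ↦ r ε * J + ε ^ 2 * (r ε * J / 2) ^ 2) (𝓝[>] 0) (𝓝 J) := by
    have : ContinuousAt (fun ε ↦ r ε * J + ε ^ 2 * (r ε * J / 2) ^ 2) 0 := by fun_prop
    simpa [ContinuousAt, r] using this.tendsto.mono_left nhdsWithin_le_nhds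
  have eventually_lt : ∀ᶠ ε in 𝓝[>] (0 : ℝ), ε * M < 1 := by
    have : ContinuousAt (fun ε : ℝ ↦ ε * M) 0 := by fun_prop
    exact nhdsWithin_le_nhds (this.eventually_lt continuousAt_const (by simp))
  refine ge_of_tendsto tendsto_bound ?_
  filter_upwards [self_mem_nhdsWithin, eventually_lt] with ε (hε : 0 < ε) hεM
  have expansion := hν.one_add_sq_mul_variance_le hK hνK hh hG hM hε hεM hGA
  refine le_of_mul_le_mul_left ?_ (pow_pos hε 2)
  simp only [r]
  linear_combination expansion

end Poincare

section GaussianMoments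

theorem integrable_pow_gaussianReal (n : ℕ) (m : ℝ) (v : NNReal) :
    Integrable (fun t : ℝ ↦ t ^ n) (gaussianReal m v) := by
  refine ((memLp_id_gaussianReal (μ := m) (v := v) (n : NNReal)).integrable_norm_pow').mono'
    (by fun_prop) (ae_of_all _ fun t ↦ ?_)
  simp

theorem hasDerivAt_gaussianPDFReal (t : ℝ) :
    HasDerivAt (gaussianPDFReal 0 1) (-t * gaussianPDFReal 0 1 t) t := by
  have exponent : HasDerivAt (fun t : ℝ ↦ -(t - 0) ^ 2 / (2 * (1 : NNReal))) (-t) t :=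
    ((((hasDerivAt_id t).sub_const 0).pow 2).neg.div_const _).congr_deriv (by simp; ring)
  exact (exponent.exp.const_mul _).congr_deriv (by rw [gaussianPDFReal]; ring)

theorem integral_pow_add_two_gaussianReal (n : ℕ) :
    ∫ t, t ^ (n + 2) ∂gaussianReal 0 1 = (n + 1) * ∫ t, t ^ n ∂gaussianReal 0 1 := by
  have integrable_pow_mul (k : ℕ) : Integrable (fun t ↦ t ^ k * gaussianPDFReal 0 1 t) := by
    have := integrable_pow_gaussianReal k 0 1
    rw [gaussianReal_of_var_ne_zero _ one_ne_zero, integrable_withDensity_iff_integrable_smul'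
      (by fun_prop) (by simp [gaussianPDF])] at this
    simpa [gaussianPDF, gaussianPDFReal_nonneg, mul_comm] using this
  have by_parts := integral_mul_deriv_eq_deriv_mul_of_integrable
    (u := fun t ↦ t ^ (n + 1)) (v := gaussianPDFReal 0 1)
    (u' := fun t ↦ ((n + 1 : ℕ) : ℝ) * t ^ n) (v' := fun t ↦ -t * gaussianPDFReal 0 1 t)
    (fun t _ ↦ by simpa using hasDerivAt_pow (n + 1) t) (fun t _ ↦ hasDerivAt_gaussianPDFReal t)
    ((integrable_pow_mul (n + 2)).neg.congr (ae_of_all _ fun t ↦ by simp; ring))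
    (((integrable_pow_mul n).const_mul (n + 1)).congr (ae_of_all _ fun t ↦ by simp; ring))
    (integrable_pow_mul (n + 1))
  simp_rw [integral_gaussianReal_eq_integral_smul one_ne_zero, smul_eq_mul]
  rw [← integral_const_mul, ← neg_inj, ← integral_neg]
  calc ∫ t, -(gaussianPDFReal 0 1 t * t ^ (n + 2))
      = ∫ t, t ^ (n + 1) * (-t * gaussianPDFReal 0 1 t) := by congr! 2; ring
    _ = -∫ t, ((n + 1 : ℕ) : ℝ) * t ^ n * gaussianPDFReal 0 1 t := by_parts
    _ = -∫ t, (n + 1) * (gaussianPDFReal 0 1 t * t ^ n) := by push_cast; congr! 3; ring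

theorem integral_sq_gaussianReal : ∫ t, t ^ 2 ∂gaussianReal 0 1 = 1 := by
  simpa using integral_pow_add_two_gaussianReal 0

theorem integral_pow_four_gaussianReal : ∫ t, t ^ 4 ∂gaussianReal 0 1 = 3 := by
  rw [integral_pow_add_two_gaussianReal 2, integral_sq_gaussianReal]
  norm_num

theorem integral_pow_six_gaussianReal : ∫ t, t ^ 6 ∂gaussianReal 0 1 = 15 := by
  rw [integral_pow_add_two_gaussianReal 4, integral_pow_four_gaussianReal]
  norm_num

variable {E : Type*} [NormedAddCommGroup E] [InnerProductSpace ℝ E] [FiniteDimensional ℝ E]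
  [MeasurableSpace E] [BorelSpace E]

theorem map_inner_stdGaussian (v : E) :
    (stdGaussian E).map (fun x ↦ ⟪v, x⟫) = gaussianReal 0 (‖v‖₊ ^ 2) := by
  have := IsGaussian.map_eq_gaussianReal (μ := stdGaussian E) (innerSL ℝ v)
  rw [integral_strongDual_stdGaussian, variance_dual_stdGaussian, innerSL_apply_norm,
    ← coe_nnnorm, ← NNReal.coe_pow, Real.toNNReal_coe] at this
  exact this

theorem integrable_inner_pow_stdGaussian (v : E) (n : ℕ) :
    Integrable (fun x ↦ ⟪v, x⟫ ^ n) (stdGaussian E) := by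
  have := integrable_pow_gaussianReal n 0 (‖v‖₊ ^ 2)
  rw [← map_inner_stdGaussian] at this
  exact this.comp_measurable (by fun_prop)

theorem integral_inner_pow_stdGaussian {v : E} (hv : ‖v‖ = 1) (n : ℕ) :
    ∫ x, ⟪v, x⟫ ^ n ∂stdGaussian E = ∫ t, t ^ n ∂gaussianReal 0 1 := by
  have map_eq := map_inner_stdGaussian v
  rw [show ‖v‖₊ = 1 from NNReal.eq hv, one_pow] at map_eq
  rw [← map_eq, integral_map (by fun_prop) (by fun_prop)]

end GaussianMoments

section BoundaryLayer

theorem abs_exp_neg_add_sub_le {t a : ℝ} (ht : 0 ≤ t) (hta : 0 ≤ t + a) :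
    |Real.exp (-(t + a)) - (1 - a) * Real.exp (-t)| ≤ a ^ 2 := by
  have tangent_le (s b : ℝ) : (1 - b) * Real.exp (-s) ≤ Real.exp (-(s + b)) := by
    rw [neg_add_rev, Real.exp_add]
    gcongr
    linarith [Real.add_one_le_exp (-b)]
  have tangent_at_t := tangent_le t a
  have tangent_at_add := tangent_le (t + a) (-a)
  rw [add_neg_cancel_right] at tangent_at_add
  have exp_t_le_one : Real.exp (-t) ≤ 1 := by simpa
  have exp_add_le_one : Real.exp (-(t + a)) ≤ 1 := by
    simpa only [Real.exp_le_one_iff, neg_nonpos] using hta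
  rw [abs_of_nonneg (by linarith)]
  calc Real.exp (-(t + a)) - (1 - a) * Real.exp (-t)
      ≤ a * (Real.exp (-t) - Real.exp (-(t + a))) := by linarith
    _ ≤ a ^ 2 := by
      rcases le_total 0 a with ha | ha <;> nlinarith

theorem mem_of_add_mem_of_sub_mem {X : Type*} [AddCommGroup X] [Module ℝ X] {K : Set X}
    (hK : Convex ℝ K) {z d : X} (h_add : z + d ∈ K) (h_sub : z - d ∈ K) : z ∈ K := by
  simpa [← two_smul ℝ z, midpoint_eq_smul_add] using hK.midpoint_mem h_add h_sub

variable {E : Type*} [NormedAddCommGroup E] [InnerProductSpace ℝ E]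

/-- The half-space on which the affine function `x ↦ ⟪w, x⟫ + θ` is nonnegative. The normal vector
`w` may vanish, in which case this is the whole space or empty. -/
def halfspace (w : E) (θ : ℝ) : Set E := {x | 0 ≤ ⟪w, x⟫ + θ}

/-- A smoothed indicator function of the points of `halfspace w θ` whose distance from the boundary
is at most of order `s`, for a unit vector `w`. -/
noncomputable def boundaryLayer (w : E) (θ s : ℝ) (x : E) : ℝ :=
  Real.exp (-(max 0 (⟪w, x⟫ + θ) / s))

theorem isClosed_halfspace (w : E) (θ : ℝ) : IsClosed (halfspace w θ) :=
  isClosed_le continuous_const (by fun_prop)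

theorem convex_halfspace (w : E) (θ : ℝ) : Convex ℝ (halfspace w θ) := by
  have := convex_halfSpace_ge (𝕜 := ℝ) (innerSL ℝ w).isBoundedLinearMap.toIsLinearMap (-θ)
  simpa [halfspace, neg_le_iff_add_nonneg] using this

theorem isClosed_biInter_halfspace {ι : Type*} (S : Finset ι) (w : ι → E) (θ : ι → ℝ) :
    IsClosed (⋂ j ∈ S, halfspace (w j) (θ j)) :=
  isClosed_biInter fun j _ ↦ isClosed_halfspace (w j) (θ j)

theorem convex_biInter_halfspace {ι : Type*} (S : Finset ι) (w : ι → E) (θ : ι → ℝ) :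
    Convex ℝ (⋂ j ∈ S, halfspace (w j) (θ j)) :=
  convex_iInter₂ fun j _ ↦ convex_halfspace (w j) (θ j)

theorem continuous_boundaryLayer (w : E) (θ s : ℝ) : Continuous (boundaryLayer w θ s) := by
  unfold boundaryLayer
  fun_prop

theorem boundaryLayer_nonneg (w : E) (θ s : ℝ) (x : E) : 0 ≤ boundaryLayer w θ s x :=
  Real.exp_nonneg _

theorem boundaryLayer_le_one (w : E) (θ : ℝ) {s : ℝ} (hs : 0 ≤ s) (x : E) :
    boundaryLayer w θ s x ≤ 1 :=
  Real.exp_le_one_iff.2 (neg_nonpos.2 (by positivity))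

theorem abs_boundaryLayer_add_sub_le {w : E} (hw : ‖w‖ = 1) {θ s : ℝ} (hs : 0 < s) {z d : E}
    (hz : z ∈ halfspace w θ) (hzd : z + d ∈ halfspace w θ) :
    |boundaryLayer w θ s (z + d) - (1 - ⟪w, d⟫ / s) * boundaryLayer w θ s z| ≤ ‖d‖ ^ 2 / s ^ 2 := by
  have increment : (⟪w, z + d⟫ + θ) / s = (⟪w, z⟫ + θ) / s + ⟪w, d⟫ / s := by
    rw [inner_add_right]
    ring
  have taylor := abs_exp_neg_add_sub_le (div_nonneg hz hs.le) (increment ▸ div_nonneg hzd hs.le)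
  rw [← increment] at taylor
  rw [boundaryLayer, boundaryLayer, max_eq_right hz.out, max_eq_right hzd.out]
  refine taylor.trans ?_
  rw [div_pow, ← sq_abs ⟪w, d⟫]
  gcongr
  simpa [hw] using abs_real_inner_le_norm w d

theorem hasMidpointGradientBoundOn_inner_add_boundaryLayer (v : E) {w : E} (hw : ‖w‖ = 1) (θ : ℝ)
    {s r : ℝ} (hs : 0 < s) (hr : 0 ≤ r) :
    HasMidpointGradientBoundOn (fun x ↦ ⟪v, x⟫ + r * s * boundaryLayer w θ s x)
      (fun x ↦ ‖v - (r * boundaryLayer w θ s x) • w‖) (halfspace w θ) := by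
  refine ⟨2 * r / s, fun z d h_add h_sub ↦ ?_⟩
  have hz := mem_of_add_mem_of_sub_mem (convex_halfspace w θ) h_add h_sub
  set ζ := boundaryLayer w θ s
  have forward : ζ (z + d) ≤ (1 - ⟪w, d⟫ / s) * ζ z + ‖d‖ ^ 2 / s ^ 2 := by
    linarith [le_of_abs_le (abs_boundaryLayer_add_sub_le hw hs hz h_add)]
  have backward : (1 + ⟪w, d⟫ / s) * ζ z - ‖d‖ ^ 2 / s ^ 2 ≤ ζ (z - d) := by
    have := neg_le_of_abs_le (abs_boundaryLayer_add_sub_le hw hs hz (sub_eq_add_neg z d ▸ h_sub))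
    rw [← sub_eq_add_neg, inner_neg_right, norm_neg, neg_div, sub_neg_eq_add] at this
    linarith
  have increment_le : ζ (z + d) - ζ (z - d) ≤ -2 * (⟪w, d⟫ / s) * ζ z + 2 * (‖d‖ ^ 2 / s ^ 2) := by
    linarith
  calc ⟪v, z + d⟫ + r * s * ζ (z + d) - (⟪v, z - d⟫ + r * s * ζ (z - d))
      = 2 * ⟪v, d⟫ + r * s * (ζ (z + d) - ζ (z - d)) := by
        rw [inner_add_right, inner_sub_right]
        ring
    _ ≤ 2 * ⟪v, d⟫ + r * s * (-2 * (⟪w, d⟫ / s) * ζ z + 2 * (‖d‖ ^ 2 / s ^ 2)) := by gcongr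
    _ = 2 * ⟪v - (r * ζ z) • w, d⟫ + 2 * r / s * ‖d‖ ^ 2 := by
        rw [inner_sub_left, real_inner_smul_left]
        field_simp
        ring
    _ ≤ 2 * ‖v - (r * ζ z) • w‖ * ‖d‖ + 2 * r / s * ‖d‖ ^ 2 := by
        rw [mul_assoc 2]
        gcongr
        exact real_inner_le_norm _ _

theorem norm_sub_smul_sq_le {v w : E} (hv : ‖v‖ = 1) (hw : ‖w‖ = 1) {t : ℝ} (ht₀ : 0 ≤ t)
    (ht₁ : t ≤ 1) : ‖v - (⟪v, w⟫ / 2 * t) • w‖ ^ 2 ≤ 1 - 3 / 4 * ⟪v, w⟫ ^ 2 * t :=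
  calc ‖v - (⟪v, w⟫ / 2 * t) • w‖ ^ 2 = 1 - ⟪v, w⟫ ^ 2 * t + ⟪v, w⟫ ^ 2 / 4 * t ^ 2 := by
        rw [norm_sub_sq_real, norm_smul, real_inner_smul_right, hv, hw, mul_one, Real.norm_eq_abs,
          sq_abs]
        ring
    _ ≤ 1 - ⟪v, w⟫ ^ 2 * t + ⟪v, w⟫ ^ 2 / 4 * t := by
        gcongr
        exact pow_le_of_le_one ht₀ ht₁ two_ne_zero
    _ = 1 - 3 / 4 * ⟪v, w⟫ ^ 2 * t := by ring

theorem abs_le_add_pow_six_div {t L : ℝ} (hL : 0 < L) : |t| ≤ L + t ^ 6 / L ^ 5 := by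
  rcases le_or_gt |t| L with h | h
  · exact h.trans (le_add_of_nonneg_right (by positivity))
  · refine le_add_of_nonneg_of_le hL.le ((le_div_iff₀ (by positivity)).2 ?_)
    calc |t| * L ^ 5 ≤ |t| * |t| ^ 5 := by gcongr
      _ = t ^ 6 := by rw [← pow_succ', Even.pow_abs (by decide)]

theorem neg_covariance_le {Ω : Type*} [MeasurableSpace Ω] {μ : Measure Ω} [IsProbabilityMeasure μ]
    {X ζ : Ω → ℝ} (hX : MemLp X 6 μ) (hX_mean : μ[X] ≤ 1) (hζ : AEStronglyMeasurable ζ μ)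
    (hζ₀ : ∀ ω, 0 ≤ ζ ω) (hζ₁ : ∀ ω, ζ ω ≤ 1) {L : ℝ} (hL : 0 < L) :
    -cov[X, ζ; μ] ≤ (1 + L) * μ[ζ] + (∫ ω, X ω ^ 6 ∂μ) / L ^ 5 := by
  have hζ_bdd : ∀ᵐ ω ∂μ, ‖ζ ω‖ ≤ 1 := ae_of_all _ fun ω ↦ by
    rw [Real.norm_of_nonneg (hζ₀ ω)]
    exact hζ₁ ω
  have hX₂ : MemLp X 2 μ := hX.mono_exponent (by norm_num)
  have hX₆ : Integrable (fun ω ↦ X ω ^ 6) μ :=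
    (hX.integrable_norm_pow (by norm_num)).congr (ae_of_all _ fun ω ↦ Even.pow_abs (by decide) _)
  have hζ_int : Integrable ζ μ := Integrable.of_bound hζ 1 hζ_bdd
  have neg_integral_mul_le : -∫ ω, X ω * ζ ω ∂μ ≤ L * μ[ζ] + (∫ ω, X ω ^ 6 ∂μ) / L ^ 5 := by
    rw [← integral_neg, ← integral_const_mul, ← integral_div,
      ← integral_add (hζ_int.const_mul L) (hX₆.div_const _)]
    refine integral_mono ((hX₂.integrable one_le_two).mul_bdd hζ hζ_bdd).neg
      ((hζ_int.const_mul L).add (hX₆.div_const _)) fun ω ↦ ?_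
    calc -(X ω * ζ ω) ≤ |X ω| * ζ ω := by
          rw [← neg_mul]
          exact mul_le_mul_of_nonneg_right (neg_le_abs _) (hζ₀ ω)
      _ ≤ (L + X ω ^ 6 / L ^ 5) * ζ ω :=
          mul_le_mul_of_nonneg_right (abs_le_add_pow_six_div hL) (hζ₀ ω)
      _ ≤ L * ζ ω + X ω ^ 6 / L ^ 5 := by
          rw [add_mul]
          gcongr
          exact mul_le_of_le_one_right (by positivity) (hζ₁ ω)
  have mean_mul_le : μ[X] * μ[ζ] ≤ μ[ζ] :=
    mul_le_of_le_one_left (integral_nonneg hζ₀) hX_mean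
  rw [covariance_eq_sub hX₂ (MemLp.of_bound hζ 1 hζ_bdd)]
  simp only [Pi.mul_apply]
  linarith

theorem variance_add_two_mul_covariance_le {Ω : Type*} [MeasurableSpace Ω] {μ : Measure Ω}
    [IsFiniteMeasure μ] {X Y : Ω → ℝ} (hX : MemLp X 2 μ) (hY : MemLp Y 2 μ) (a : ℝ) :
    Var[X; μ] + 2 * (a * cov[X, Y; μ]) ≤ Var[fun ω ↦ X ω + a * Y ω; μ] := by
  rw [← covariance_const_mul_right]
  exact (variance_add hX (hY.const_mul a)).ge.trans' (le_add_of_nonneg_right (variance_nonneg _ _))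

variable [MeasurableSpace E] [BorelSpace E]

theorem LogConcaveWith.integral_boundaryLayer_le {ν : Measure E} [IsProbabilityMeasure ν]
    (hν : LogConcaveWith (fun d ↦ ‖d‖ ^ 2) ν) {v w : E} (hv : ‖v‖ = 1) (hw : ‖w‖ = 1) {θ : ℝ}
    (hνw : ∀ᵐ x ∂ν, x ∈ halfspace w θ) {c s L : ℝ} (hvw : ⟪v, w⟫ = c) (hc : 0 < c) (hs : 0 < s)
    (hL : 0 < L) (hsL : s * (1 + L) ≤ c / 4) (hX : MemLp (fun x ↦ ⟪v, x⟫) 6 ν)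
    (hX_mean : ∫ x, ⟪v, x⟫ ∂ν ≤ 1) :
    c ^ 2 / 2 * ∫ x, boundaryLayer w θ s x ∂ν ≤
      1 - Var[fun x ↦ ⟪v, x⟫; ν] + c * s * ((∫ x, ⟪v, x⟫ ^ 6 ∂ν) / L ^ 5) := by
  set X : E → ℝ := fun x ↦ ⟪v, x⟫
  set ζ := boundaryLayer w θ s
  have hζ : Continuous ζ := continuous_boundaryLayer w θ s
  have hζ₀ : ∀ x, 0 ≤ ζ x := boundaryLayer_nonneg w θ s
  have hζ₁ : ∀ x, ζ x ≤ 1 := boundaryLayer_le_one w θ hs.le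
  have hζ_memLp (p : ℝ≥0∞) : MemLp ζ p ν :=
    MemLp.of_bound hζ.aestronglyMeasurable 1 (ae_of_all _ fun x ↦ by
      simpa only [Real.norm_of_nonneg (hζ₀ x)] using hζ₁ x)
  have hζ_int : Integrable ζ ν := memLp_one_iff_integrable.1 (hζ_memLp 1)
  -- In the direction `v`, adding `c / 2 * s * ζ` lowers the squared gradient by order `c ^ 2` on
  -- the layer, while it changes the variance only by a covariance of order `s`.
  have gradient_sq_le (x : E) : ‖v - (c / 2 * ζ x) • w‖ ^ 2 ≤ 1 - 3 / 4 * c ^ 2 * ζ x :=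
    hvw ▸ norm_sub_smul_sq_le hv hw (hζ₀ x) (hζ₁ x)
  have poincare : Var[fun x ↦ X x + c / 2 * s * ζ x; ν] ≤ 1 - 3 / 4 * c ^ 2 * ν[ζ] :=
    calc Var[fun x ↦ X x + c / 2 * s * ζ x; ν]
        ≤ ∫ x, ‖v - (c / 2 * ζ x) • w‖ ^ 2 ∂ν :=
          hν.variance_le_integral_sq (isClosed_halfspace w θ).measurableSet hνw (by fun_prop)
            (by fun_prop) (hasMidpointGradientBoundOn_inner_add_boundaryLayer v hw θ hs
              (by positivity)) fun x ↦ (gradient_sq_le x).trans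
                (sub_le_self 1 (mul_nonneg (by positivity) (hζ₀ x)))
      _ ≤ ∫ x, (1 - 3 / 4 * c ^ 2 * ζ x) ∂ν :=
          integral_mono_of_nonneg (ae_of_all _ fun x ↦ sq_nonneg _)
            ((integrable_const 1).sub (hζ_int.const_mul _)) (ae_of_all _ gradient_sq_le)
      _ = 1 - 3 / 4 * c ^ 2 * ν[ζ] := by
          rw [integral_sub (integrable_const 1) (hζ_int.const_mul _), integral_const_mul]
          simp
  have variance_lower := variance_add_two_mul_covariance_le (hX.mono_exponent (by norm_num))
    (hζ_memLp 2) (c / 2 * s)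
  have covariance_lower := neg_covariance_le hX hX_mean hζ.aestronglyMeasurable hζ₀ hζ₁ hL
  have layer_absorbed : c * (s * (1 + L)) * ν[ζ] ≤ c * (c / 4) * ν[ζ] := by
    have : 0 ≤ ν[ζ] := integral_nonneg hζ₀
    gcongr
  linarith [mul_le_mul_of_nonneg_left covariance_lower (mul_pos hc hs).le]

end BoundaryLayer

section Conditioning

theorem integral_cond {Ω : Type*} [MeasurableSpace Ω] (μ : Measure Ω) (s : Set Ω) (f : Ω → ℝ) :
    ∫ x, f x ∂μ[|s] = (μ.real s)⁻¹ * ∫ x in s, f x ∂μ := by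
  rw [ProbabilityTheory.cond, integral_smul_measure, ENNReal.toReal_inv, smul_eq_mul,
    measureReal_def]

theorem memLp_cond {Ω : Type*} [MeasurableSpace Ω] {μ : Measure Ω} {f : Ω → ℝ} {p : ℝ≥0∞}
    (hf : MemLp f p μ) {s : Set Ω} (hs : μ s ≠ 0) : MemLp f p μ[|s] :=
  (hf.restrict s).smul_measure (by simpa using hs)

theorem LogConcaveWith.cond {X : Type*} [AddCommGroup X] [Module ℝ X] [MeasurableSpace X]
    {q : X → ℝ} {μ : Measure X} (hμ : LogConcaveWith q μ) {K : Set X} (hK : MeasurableSet K)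
    (hK_convex : Convex ℝ K) : LogConcaveWith q μ[|K] :=
  (hμ.restrict hK fun _ _ ↦ mem_of_add_mem_of_sub_mem hK_convex).const_smul _

variable {E : Type*} [NormedAddCommGroup E] [InnerProductSpace ℝ E] [MeasurableSpace E]
  [BorelSpace E] [FiniteDimensional ℝ E]

theorem memLp_inner_stdGaussian (v : E) (p : NNReal) :
    MemLp (fun x ↦ ⟪v, x⟫) p (stdGaussian E) :=
  IsGaussian.memLp_dual (stdGaussian E) (innerSL ℝ v) p ENNReal.coe_ne_top

theorem setIntegral_inner_pow_six_stdGaussian_le {v : E} (hv : ‖v‖ = 1) (K : Set E) :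
    ∫ x in K, ⟪v, x⟫ ^ 6 ∂stdGaussian E ≤ 15 := by
  rw [← integral_pow_six_gaussianReal, ← integral_inner_pow_stdGaussian hv]
  exact setIntegral_le_integral (integrable_inner_pow_stdGaussian v 6)
    (ae_of_all _ fun x ↦ by positivity)

theorem mul_one_sub_variance_cond_le {Ω : Type*} [MeasurableSpace Ω] {μ : Measure Ω}
    [IsFiniteMeasure μ] {X : Ω → ℝ} (hX : MemLp X 2 μ) {K : Set Ω} (hK : 0 < μ.real K) {δ : ℝ}
    (hδ : δ ≤ μ.real K) (h_mean : |∫ x in K, X x ∂μ| ≤ δ) :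
    μ.real K * (1 - Var[X; μ[|K]]) ≤ ∫ x in K, (1 - X x ^ 2) ∂μ + δ := by
  have hμK : μ K ≠ 0 := (ENNReal.toReal_pos_iff.1 hK).1.ne'
  have : IsProbabilityMeasure μ[|K] := cond_isProbabilityMeasure hμK
  have mean_sq_le : (∫ x in K, X x ∂μ) ^ 2 ≤ δ * μ.real K := by
    rw [← sq_abs]
    nlinarith [abs_nonneg (∫ x in K, X x ∂μ)]
  rw [variance_eq_sub (memLp_cond hX hμK),
    integral_sub (integrable_const 1) hX.integrable_sq.restrict]
  simp only [integral_cond, Pi.pow_apply]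
  calc μ.real K *
        (1 - ((μ.real K)⁻¹ * ∫ x in K, X x ^ 2 ∂μ - ((μ.real K)⁻¹ * ∫ x in K, X x ∂μ) ^ 2))
      = μ.real K - ∫ x in K, X x ^ 2 ∂μ + (∫ x in K, X x ∂μ) ^ 2 / μ.real K := by
        field_simp
        ring
    _ ≤ ∫ x in K, 1 ∂μ - ∫ x in K, X x ^ 2 ∂μ + δ := by
        rw [setIntegral_const, smul_eq_mul, mul_one]
        gcongr
        exact (div_le_iff₀ hK).2 mean_sq_le

theorem setIntegral_boundaryLayer_le {K : Set E} (hK : MeasurableSet K) (hK_convex : Convex ℝ K)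
    {v w : E} (hv : ‖v‖ = 1) (hw : ‖w‖ = 1) {θ : ℝ} (hKw : K ⊆ halfspace w θ) {c s L δ : ℝ}
    (hvw : ⟪v, w⟫ = c) (hc : 0 < c) (hs : 0 < s) (hL : 0 < L) (hsL : s * (1 + L) ≤ c / 4)
    (hδ₀ : 0 < δ) (hδK : δ ≤ (stdGaussian E).real K)
    (h_mean : |∫ x in K, ⟪v, x⟫ ∂stdGaussian E| ≤ δ)
    (h_sq : ∫ x in K, (1 - ⟪v, x⟫ ^ 2) ∂stdGaussian E ≤ 2 * δ) :
    c ^ 2 / 2 * ∫ x in K, boundaryLayer w θ s x ∂stdGaussian E ≤ 3 * δ + c * s * (15 / L ^ 5) := by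
  set γ := stdGaussian E
  have hκ : 0 < γ.real K := hδ₀.trans_le hδK
  have hγK : γ K ≠ 0 := (ENNReal.toReal_pos_iff.1 hκ).1.ne'
  have : IsProbabilityMeasure γ[|K] := cond_isProbabilityMeasure hγK
  have cond_bound := (logConcaveWith_stdGaussian.cond hK hK_convex).integral_boundaryLayer_le hv hw
    ((ae_cond_mem hK).mono hKw) hvw hc hs hL hsL
    (memLp_cond (memLp_inner_stdGaussian v 6) hγK) <| by
      rw [integral_cond, inv_mul_le_one₀ hκ]
      exact (le_of_abs_le h_mean).trans hδK
  have variance_bound := mul_one_sub_variance_cond_le (memLp_inner_stdGaussian v 2) hκ hδK h_mean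
  have sixth_moment_bound := setIntegral_inner_pow_six_stdGaussian_le hv K
  rw [integral_cond, integral_cond] at cond_bound
  calc c ^ 2 / 2 * ∫ x in K, boundaryLayer w θ s x ∂γ
      = γ.real K * (c ^ 2 / 2 * ((γ.real K)⁻¹ * ∫ x in K, boundaryLayer w θ s x ∂γ)) := by
        field_simp
    _ ≤ γ.real K * (1 - Var[fun x ↦ ⟪v, x⟫; γ[|K]] +
          c * s * ((γ.real K)⁻¹ * (∫ x in K, ⟪v, x⟫ ^ 6 ∂γ) / L ^ 5)) := by gcongr
    _ = γ.real K * (1 - Var[fun x ↦ ⟪v, x⟫; γ[|K]]) +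
          c * s * ((∫ x in K, ⟪v, x⟫ ^ 6 ∂γ) / L ^ 5) := by
        field_simp
    _ ≤ (2 * δ + δ) + c * s * (15 / L ^ 5) := by
        gcongr
        linarith
    _ = 3 * δ + c * s * (15 / L ^ 5) := by ring

end Conditioning

section Cutting

theorem abs_one_sub_exp_neg_sq_add_sub_le {t a : ℝ} (ht : 0 ≤ t) (hta : 0 ≤ t + a) :
    |(1 - Real.exp (-(t + a))) ^ 2 - (1 - Real.exp (-t)) ^ 2 -
      2 * a * ((1 - Real.exp (-t)) * Real.exp (-t))| ≤ 6 * a ^ 2 := by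
  have exp_neg_sq (r : ℝ) : Real.exp (-r) ^ 2 = Real.exp (-(2 * r)) := by
    rw [← Real.exp_nat_mul]
    push_cast
    ring_nf
  have taylor := abs_le.1 (abs_exp_neg_add_sub_le ht hta)
  have taylor_two_mul := abs_le.1 (abs_exp_neg_add_sub_le (t := 2 * t) (a := 2 * a)
    (by linarith) (by linarith))
  rw [← mul_add, ← exp_neg_sq, ← exp_neg_sq] at taylor_two_mul
  rw [abs_le]
  constructor <;> linarith

theorem hasMidpointGradientBoundOn_one_sub_exp_neg_sq {E : Type*} [NormedAddCommGroup E]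
    {m : E → ℝ} (hm : LipschitzWith 1 m) (hm₀ : ∀ x, 0 ≤ m x) {s : ℝ} (hs : 0 < s) :
    HasMidpointGradientBoundOn (fun x ↦ (1 - Real.exp (-(m x / s))) ^ 2)
      (fun x ↦ 2 / s * ((1 - Real.exp (-(m x / s))) * Real.exp (-(m x / s)))) Set.univ := by
  refine ⟨12 / s ^ 2, fun z d _ _ ↦ ?_⟩
  have abs_sub_le (x y : E) : |m x - m y| ≤ ‖x - y‖ := by
    simpa [Real.dist_eq, dist_eq_norm] using hm.dist_le_mul x y
  set e : E → ℝ := fun x ↦ Real.exp (-(m x / s))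
  have slope_nonneg : 0 ≤ (1 - e z) * e z :=
    mul_nonneg (sub_nonneg.2 (Real.exp_le_one_iff.2 (neg_nonpos.2 (div_nonneg (hm₀ z) hs.le))))
      (Real.exp_nonneg _)
  have taylor (x : E) (hx : ‖x - z‖ = ‖d‖) :
      |(1 - e x) ^ 2 - (1 - e z) ^ 2 - 2 * ((m x - m z) / s) * ((1 - e z) * e z)| ≤
        6 * (‖d‖ ^ 2 / s ^ 2) := by
    have := abs_one_sub_exp_neg_sq_add_sub_le (t := m z / s) (a := (m x - m z) / s)
      (div_nonneg (hm₀ z) hs.le) (by rw [← add_div, add_sub_cancel]; exact div_nonneg (hm₀ x) hs.le)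
    rw [← add_div, add_sub_cancel] at this
    refine this.trans ?_
    rw [div_pow, ← sq_abs (m x - m z), ← hx]
    gcongr
    exact abs_sub_le x z
  have forward := le_of_abs_le (taylor (z + d) (by simp))
  have backward := neg_le_of_abs_le (taylor (z - d) (by simp))
  have increment_le : (m (z + d) - m (z - d)) / s ≤ 2 * ‖d‖ / s := by
    gcongr
    calc m (z + d) - m (z - d) ≤ ‖z + d - (z - d)‖ := (le_abs_self _).trans (abs_sub_le _ _)
      _ = ‖d + d‖ := by abel_nf
      _ ≤ 2 * ‖d‖ := by simpa [two_mul] using norm_add_le d d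
  calc (1 - e (z + d)) ^ 2 - (1 - e (z - d)) ^ 2
      ≤ 2 * ((m (z + d) - m (z - d)) / s) * ((1 - e z) * e z) + 12 / s ^ 2 * ‖d‖ ^ 2 := by
        linear_combination forward + backward
    _ ≤ 2 * (2 * ‖d‖ / s) * ((1 - e z) * e z) + 12 / s ^ 2 * ‖d‖ ^ 2 := by gcongr
    _ = 2 * (2 / s * ((1 - e z) * e z)) * ‖d‖ + 12 / s ^ 2 * ‖d‖ ^ 2 := by ring

theorem sq_setIntegral_le {Ω : Type*} [MeasurableSpace Ω] {μ : Measure Ω} [IsFiniteMeasure μ]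
    {f : Ω → ℝ} (hf : MemLp f 2 μ) (A : Set Ω) :
    (∫ x in A, f x ∂μ) ^ 2 ≤ μ.real A * ∫ x in A, f x ^ 2 ∂μ := by
  rcases eq_or_ne (μ A) 0 with hA | hA
  · simp [Measure.restrict_eq_zero.2 hA, measureReal_def, hA]
  have : IsProbabilityMeasure μ[|A] := cond_isProbabilityMeasure hA
  have hA_pos : 0 < μ.real A := ENNReal.toReal_pos hA (measure_ne_top μ A)
  have variance_cond_nonneg := variance_nonneg f μ[|A]
  rw [variance_eq_sub (memLp_cond hf hA), integral_cond, integral_cond] at variance_cond_nonneg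
  have := mul_nonneg (sq_nonneg (μ.real A)) variance_cond_nonneg
  simp only [Pi.pow_apply] at this
  field_simp at this
  linarith

theorem one_sub_measureReal_mul_sq_integral_le {Ω : Type*} [MeasurableSpace Ω] {μ : Measure Ω}
    [IsProbabilityMeasure μ] {f : Ω → ℝ} (hf : MemLp f 2 μ) {A : Set Ω} (hfA : ∀ x ∉ A, f x = 0) :
    (1 - μ.real A) * (∫ x, f x ∂μ) ^ 2 ≤ μ.real A * Var[f; μ] := by
  have cauchy_schwarz := sq_setIntegral_le hf A
  rw [setIntegral_eq_integral_of_forall_compl_eq_zero hfA,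
    setIntegral_eq_integral_of_forall_compl_eq_zero fun x hx ↦ by simp [hfA x hx]] at cauchy_schwarz
  rw [variance_eq_sub hf]
  simp only [Pi.pow_apply]
  linarith

theorem measureReal_sub_two_mul_setIntegral_le {Ω : Type*} [MeasurableSpace Ω] {μ : Measure Ω}
    [IsFiniteMeasure μ] {e : Ω → ℝ} (he : Measurable e) (he₀ : ∀ x, 0 ≤ e x) (he₁ : ∀ x, e x ≤ 1)
    {A : Set Ω} (heA : ∀ x ∉ A, e x = 1) :
    μ.real A - 2 * ∫ x in A, e x ∂μ ≤ ∫ x, (1 - e x) ^ 2 ∂μ := by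
  have integrable_e : Integrable e (μ.restrict A) :=
    .of_bound he.aestronglyMeasurable 1 (ae_of_all _ fun x ↦ by
      simpa [abs_of_nonneg (he₀ x)] using he₁ x)
  have integrable_sq : Integrable (fun x ↦ (1 - e x) ^ 2) (μ.restrict A) :=
    .of_bound (by fun_prop) 1 (ae_of_all _ fun x ↦ by
      simpa [abs_le] using ⟨by linarith [he₁ x], he₀ x⟩)
  calc μ.real A - 2 * ∫ x in A, e x ∂μ = ∫ x in A, (1 - 2 * e x) ∂μ := by
        rw [integral_sub (integrable_const 1) (integrable_e.const_mul 2), integral_const_mul,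
          setIntegral_const, smul_eq_mul, mul_one]
    _ ≤ ∫ x in A, (1 - e x) ^ 2 ∂μ :=
        integral_mono ((integrable_const 1).sub (integrable_e.const_mul 2)) integrable_sq
          fun x ↦ by linarith [sq_nonneg (e x)]
    _ = ∫ x, (1 - e x) ^ 2 ∂μ :=
        setIntegral_eq_integral_of_forall_compl_eq_zero fun x hx ↦ by simp [heA x hx]

theorem sq_one_sub_mul_self_le {r : ℝ} (hr₀ : 0 ≤ r) (hr₁ : r ≤ 1) : ((1 - r) * r) ^ 2 ≤ r := by
  have : (1 - r) * r ≤ 1 * 1 := by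
    gcongr
    linarith
  nlinarith [mul_nonneg (sub_nonneg.2 hr₁) hr₀]

theorem integral_sq_const_mul_mul_le_setIntegral {Ω : Type*} [MeasurableSpace Ω] {μ : Measure Ω}
    [IsFiniteMeasure μ] {e : Ω → ℝ} (he : Measurable e) (he₀ : ∀ x, 0 ≤ e x) (he₁ : ∀ x, e x ≤ 1)
    {A : Set Ω} (heA : ∀ x ∉ A, e x = 1) (c : ℝ) :
    ∫ x, (c * ((1 - e x) * e x)) ^ 2 ∂μ ≤ c ^ 2 * ∫ x in A, e x ∂μ := by
  have sq_le (x : Ω) : (c * ((1 - e x) * e x)) ^ 2 ≤ c ^ 2 * e x := by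
    rw [mul_pow]
    gcongr
    exact sq_one_sub_mul_self_le (he₀ x) (he₁ x)
  rw [← setIntegral_eq_integral_of_forall_compl_eq_zero fun x hx ↦ by simp [heA x hx],
    ← integral_const_mul]
  refine integral_mono_of_nonneg (ae_of_all _ fun x ↦ sq_nonneg _) ?_ (ae_of_all _ sq_le)
  exact (Integrable.of_bound he.aestronglyMeasurable 1 (ae_of_all _ fun x ↦ by
    simpa [abs_of_nonneg (he₀ x)] using he₁ x)).const_mul _

theorem one_sub_mul_le_of_one_sub_mul_sq_le {a p R : ℝ} (ha₀ : 0 ≤ a) (ha₁ : a ≤ 1)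
    (hap : a / 2 ≤ p) (hR : 0 ≤ R) (h : (1 - a) * p ^ 2 ≤ a * R) : (1 - a) * a ≤ 4 * R := by
  rcases ha₀.eq_or_lt with rfl | ha
  · simpa using hR
  have := sub_nonneg.2 ha₁
  refine le_of_mul_le_mul_left ?_ ha
  calc a * ((1 - a) * a) = 4 * ((1 - a) * (a / 2) ^ 2) := by ring
    _ ≤ 4 * ((1 - a) * p ^ 2) := by gcongr
    _ ≤ a * (4 * R) := by linarith

theorem LogConcaveWith.one_sub_mul_measureReal_le {E : Type*} [NormedAddCommGroup E]
    [MeasurableSpace E] [BorelSpace E] {ν : Measure E} [IsProbabilityMeasure ν]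
    (hν : LogConcaveWith (fun d ↦ ‖d‖ ^ 2) ν) {m : E → ℝ} (hm : LipschitzWith 1 m)
    (hm₀ : ∀ x, 0 ≤ m x) {A : Set E} (hmA : ∀ x ∉ A, m x = 0) {s : ℝ} (hs : 0 < s) (hs₂ : s ≤ 2) :
    (1 - ν.real A) * ν.real A ≤ 16 / s ^ 2 * ∫ x in A, Real.exp (-(m x / s)) ∂ν := by
  set e : E → ℝ := fun x ↦ Real.exp (-(m x / s))
  have he₀ (x : E) : 0 ≤ e x := Real.exp_nonneg _
  have he₁ (x : E) : e x ≤ 1 :=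
    Real.exp_le_one_iff.2 (neg_nonpos.2 (div_nonneg (hm₀ x) hs.le))
  have heA : ∀ x ∉ A, e x = 1 := fun x hx ↦ by simp [e, hmA x hx]
  have measurable_m := hm.continuous.measurable
  have he : Measurable e := by fun_prop
  have mass_bound := measureReal_sub_two_mul_setIntegral_le (μ := ν) he he₀ he₁ heA
  have energy_bound := integral_sq_const_mul_mul_le_setIntegral (μ := ν) he he₀ he₁ heA (2 / s)
  have poincare := hν.variance_le_integral_sq .univ (by simp) (by fun_prop) (by fun_prop)
    (hasMidpointGradientBoundOn_one_sub_exp_neg_sq hm hm₀ hs) (A := (2 / s) ^ 2) fun x ↦ by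
      rw [mul_pow]
      exact mul_le_of_le_one_right (sq_nonneg _)
        ((sq_one_sub_mul_self_le (he₀ x) (he₁ x)).trans (he₁ x))
  have mass_sq_bound := one_sub_measureReal_mul_sq_integral_le (μ := ν) (A := A)
    (f := fun x ↦ (1 - e x) ^ 2)
    (.of_bound (by fun_prop) 1 (ae_of_all _ fun x ↦ by
      simpa [abs_le] using ⟨by linarith [he₁ x], he₀ x⟩))
    fun x hx ↦ by simp [heA x hx]
  have variance_bound := poincare.trans energy_bound
  rw [div_pow] at variance_bound
  set a := ν.real A
  set Z := ∫ x in A, e x ∂ν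
  have ha₀ : 0 ≤ a := measureReal_nonneg
  have ha₁ : a ≤ 1 := measureReal_le_one
  have : 0 ≤ Z := integral_nonneg he₀
  rcases le_or_gt Z (a / 4) with hZa | hZa
  · calc (1 - a) * a ≤ 4 * (2 ^ 2 / s ^ 2 * Z) :=
          one_sub_mul_le_of_one_sub_mul_sq_le ha₀ ha₁ (by linarith) (by positivity)
            (mass_sq_bound.trans (mul_le_mul_of_nonneg_left variance_bound ha₀))
      _ = 16 / s ^ 2 * Z := by ring
  · calc (1 - a) * a ≤ a := mul_le_of_le_one_left ha₀ (by linarith)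
      _ ≤ 16 / 2 ^ 2 * Z := by linarith
      _ ≤ 16 / s ^ 2 * Z := by gcongr

variable {E : Type*} [NormedAddCommGroup E] [InnerProductSpace ℝ E]

theorem exp_neg_infDist_le_sum_boundaryLayer {ι : Type*} {S : Finset ι} (hS : S.Nonempty)
    {w : ι → E} (hw : ∀ j ∈ S, ‖w j‖ = 1) (θ : ι → ℝ) {s : ℝ} (hs : 0 < s) {x : E}
    (hx : ∀ j ∈ S, x ∈ halfspace (w j) (θ j)) :
    Real.exp (-(Metric.infDist x (⋂ j ∈ S, halfspace (w j) (θ j))ᶜ / s)) ≤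
      ∑ j ∈ S, boundaryLayer (w j) (θ j) s x := by
  have nonempty_compl : (⋂ j ∈ S, halfspace (w j) (θ j))ᶜ.Nonempty := by
    obtain ⟨i, hi⟩ := hS
    refine ⟨(-θ i - 1) • w i, fun h ↦ ?_⟩
    have := (Set.mem_iInter₂.1 h i hi).out
    rw [real_inner_smul_right, real_inner_self_eq_norm_sq, hw i hi] at this
    linarith
  obtain ⟨i, hi, hmin⟩ := S.exists_min_image (fun j ↦ ⟪w j, x⟫ + θ j) hS
  have le_infDist : ⟪w i, x⟫ + θ i ≤ Metric.infDist x (⋂ j ∈ S, halfspace (w j) (θ j))ᶜ := by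
    refine (Metric.le_infDist nonempty_compl).2 fun y hy ↦ ?_
    simp only [halfspace, Set.mem_compl_iff, Set.mem_iInter, Set.mem_ofPred_eq, not_forall,
      not_le] at hy
    obtain ⟨j, hj, hy⟩ := hy
    have inner_le_dist := real_inner_le_norm (w j) (x - y)
    rw [hw j hj, one_mul, inner_sub_right, ← dist_eq_norm] at inner_le_dist
    linarith [hmin j hj]
  calc Real.exp (-(Metric.infDist x (⋂ j ∈ S, halfspace (w j) (θ j))ᶜ / s))
      ≤ boundaryLayer (w i) (θ i) s x := by
        rw [boundaryLayer, max_eq_right (hx i hi).out]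
        gcongr
    _ ≤ ∑ j ∈ S, boundaryLayer (w j) (θ j) s x :=
        S.single_le_sum (f := fun j ↦ boundaryLayer (w j) (θ j) s x)
          (fun j _ ↦ boundaryLayer_nonneg _ _ _ _) hi

variable [FiniteDimensional ℝ E] [MeasurableSpace E] [BorelSpace E]

theorem measureReal_sub_measureReal_inter_mul_le {K A : Set E} (hK : MeasurableSet K)
    (hK_convex : Convex ℝ K) (hA : MeasurableSet A) {s : ℝ} (hs : 0 < s) (hs₂ : s ≤ 2) :
    ((stdGaussian E).real K - (stdGaussian E).real (K ∩ A)) * (stdGaussian E).real (K ∩ A) ≤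
      16 / s ^ 2 * ∫ x in K ∩ A, Real.exp (-(Metric.infDist x Aᶜ / s)) ∂stdGaussian E := by
  set γ := stdGaussian E
  set Y := ∫ x in K ∩ A, Real.exp (-(Metric.infDist x Aᶜ / s)) ∂γ
  have : 0 ≤ Y := integral_nonneg fun _ ↦ Real.exp_nonneg _
  rcases (measureReal_nonneg (μ := γ) (s := K)).eq_or_lt with hκ | hκ
  · have : γ.real (K ∩ A) = 0 :=
      le_antisymm (hκ ▸ measureReal_mono Set.inter_subset_left) measureReal_nonneg
    rw [this, mul_zero]
    positivity
  have hγK : γ K ≠ 0 := (ENNReal.toReal_pos_iff.1 hκ).1.ne'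
  have : IsProbabilityMeasure γ[|K] := cond_isProbabilityMeasure hγK
  have cond_bound := (logConcaveWith_stdGaussian.cond hK hK_convex).one_sub_mul_measureReal_le
    (Metric.lipschitz_infDist_pt Aᶜ) (fun _ ↦ Metric.infDist_nonneg)
    (fun x hx ↦ Metric.infDist_zero_of_mem hx) hs hs₂ (A := A)
  rw [measureReal_def, cond_apply hK, ENNReal.toReal_mul, ENNReal.toReal_inv, ← measureReal_def,
    ← measureReal_def, ProbabilityTheory.cond, Measure.restrict_smul, Measure.restrict_restrict hA,
    integral_smul_measure, ENNReal.toReal_inv, Set.inter_comm A K, smul_eq_mul] at cond_bound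
  change _ ≤ 16 / s ^ 2 * ((γ.real K)⁻¹ * Y) at cond_bound
  calc (γ.real K - γ.real (K ∩ A)) * γ.real (K ∩ A)
      = γ.real K ^ 2 *
          ((1 - (γ.real K)⁻¹ * γ.real (K ∩ A)) * ((γ.real K)⁻¹ * γ.real (K ∩ A))) := by
        field_simp
    _ ≤ γ.real K ^ 2 * (16 / s ^ 2 * ((γ.real K)⁻¹ * Y)) := by gcongr
    _ = γ.real K * (16 / s ^ 2 * Y) := by field_simp
    _ ≤ 16 / s ^ 2 * Y := mul_le_of_le_one_left (by positivity) measureReal_le_one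

theorem measureReal_sub_measureReal_inter_biInter_halfspace_mul_le {K : Set E}
    (hK : MeasurableSet K) (hK_convex : Convex ℝ K) {ι : Type*} {S : Finset ι} {w : ι → E}
    (hw : ∀ j ∈ S, ‖w j‖ = 1) (θ : ι → ℝ) {s : ℝ} (hs : 0 < s) (hs₂ : s ≤ 2) :
    ((stdGaussian E).real K - (stdGaussian E).real (K ∩ ⋂ j ∈ S, halfspace (w j) (θ j))) *
        (stdGaussian E).real (K ∩ ⋂ j ∈ S, halfspace (w j) (θ j)) ≤
      16 / s ^ 2 * ∑ j ∈ S, ∫ x in K ∩ ⋂ j ∈ S, halfspace (w j) (θ j),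
        boundaryLayer (w j) (θ j) s x ∂stdGaussian E := by
  rcases S.eq_empty_or_nonempty with rfl | hS
  · simp
  set A := ⋂ j ∈ S, halfspace (w j) (θ j)
  have hA : MeasurableSet A := (isClosed_biInter_halfspace S w θ).measurableSet
  have integrable_boundaryLayer (j : ι) :
      Integrable (boundaryLayer (w j) (θ j) s) ((stdGaussian E).restrict (K ∩ A)) :=
    .of_bound (continuous_boundaryLayer _ _ _).aestronglyMeasurable 1 (ae_of_all _ fun x ↦ by
      simpa [abs_of_nonneg (boundaryLayer_nonneg _ _ _ _)] using
        boundaryLayer_le_one (w j) (θ j) hs.le x)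
  refine (measureReal_sub_measureReal_inter_mul_le hK hK_convex hA hs hs₂).trans ?_
  rw [← integral_finsetSum _ fun j _ ↦ integrable_boundaryLayer j]
  refine mul_le_mul_of_nonneg_left ?_ (by positivity)
  refine integral_mono_of_nonneg (ae_of_all _ fun x ↦ Real.exp_nonneg _)
    (integrable_finsetSum _ fun j _ ↦ integrable_boundaryLayer j) ?_
  filter_upwards [ae_restrict_mem (hK.inter hA)] with x hx
  exact exp_neg_infDist_le_sum_boundaryLayer hS hw θ hs (Set.mem_iInter₂.1 hx.2)

end Cutting

section Rounding

theorem gaussianPDFReal_le_one (m : ℝ) {v : NNReal} (hv : (1 : ℝ) / 4 ≤ v) (x : ℝ) :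
    gaussianPDFReal m v x ≤ 1 := by
  rw [gaussianPDFReal]
  refine mul_le_one₀ (inv_le_one_of_one_le₀ ?_) (Real.exp_nonneg _) (Real.exp_le_one_iff.2 ?_)
  · rw [Real.one_le_sqrt]
    nlinarith [Real.pi_gt_three]
  · exact div_nonpos_of_nonpos_of_nonneg (neg_nonpos.2 (sq_nonneg _)) (by positivity)

theorem gaussianReal_le_volume (m : ℝ) {v : NNReal} (hv : (1 : ℝ) / 4 ≤ v) :
    gaussianReal m v ≤ volume := by
  have v_ne_zero : v ≠ 0 := by
    rintro rfl
    norm_num at hv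
  rw [gaussianReal_of_var_ne_zero m v_ne_zero]
  calc volume.withDensity (gaussianPDF m v) ≤ volume.withDensity 1 :=
        withDensity_mono (ae_of_all _ fun x ↦
          ENNReal.ofReal_le_one.2 (gaussianPDFReal_le_one m hv x))
    _ = volume := withDensity_one

theorem measureReal_biInter_symmDiff_biInter_le {Ω ι : Type*} [MeasurableSpace Ω] {μ : Measure Ω}
    [IsFiniteMeasure μ] (S : Finset ι) (A B : ι → Set Ω) :
    μ.real ((⋂ j ∈ S, A j) ∆ (⋂ j ∈ S, B j)) ≤ ∑ j ∈ S, μ.real (A j ∆ B j) := by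
  have subset : (⋂ j ∈ S, A j) ∆ (⋂ j ∈ S, B j) ⊆ ⋃ j ∈ S, A j ∆ B j := by
    intro x hx
    simp only [Set.mem_symmDiff, Set.mem_iInter, Set.mem_iUnion] at hx ⊢
    grind
  exact (measureReal_mono subset (measure_ne_top μ _)).trans (measureReal_biUnion_finset_le S _)

variable {E : Type*} [NormedAddCommGroup E] [InnerProductSpace ℝ E]

theorem halfspace_symmDiff_halfspace_subset (w u : E) (θ r : ℝ) :
    halfspace w θ ∆ halfspace u θ ⊆
      (fun x ↦ ⟪u, x⟫) ⁻¹' Set.Icc (-θ - r) (-θ + r) ∪ {x | r ≤ |⟪w - u, x⟫|} := by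
  intro x hx
  by_contra hcon
  simp only [Set.mem_union, Set.mem_preimage, Set.mem_Icc, Set.mem_ofPred_eq, not_or, not_and_or,
    not_le, inner_sub_left, abs_lt] at hcon
  simp only [halfspace, Set.mem_symmDiff, Set.mem_ofPred_eq, not_le] at hx
  grind

theorem starProjection_mem_halfspace_iff {V : Submodule ℝ E} [V.HasOrthogonalProjection] {w : E}
    (hw : w ∈ V) (θ : ℝ) (x : E) : V.starProjection x ∈ halfspace w θ ↔ x ∈ halfspace w θ := by
  rw [halfspace, Set.mem_ofPred_eq, Set.mem_ofPred_eq,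
    ← Submodule.inner_starProjection_left_eq_right, Submodule.starProjection_eq_self_iff.2 hw]

variable [FiniteDimensional ℝ E] [MeasurableSpace E] [BorelSpace E]

theorem integral_inner_sq_stdGaussian (v : E) : ∫ x, ⟪v, x⟫ ^ 2 ∂stdGaussian E = ‖v‖ ^ 2 := by
  have variance_eq := variance_dual_stdGaussian (E := E) (innerSL ℝ v)
  rwa [variance_of_integral_eq_zero (by fun_prop) (integral_strongDual_stdGaussian _),
    innerSL_apply_norm] at variance_eq

theorem measureReal_le_abs_inner_stdGaussian (v : E) {r : ℝ} (hr : 0 < r) :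
    (stdGaussian E).real {x | r ≤ |⟪v, x⟫|} ≤ ‖v‖ ^ 2 / r ^ 2 := by
  have markov := mul_meas_ge_le_integral_of_nonneg (ae_of_all _ fun x ↦ sq_nonneg ⟪v, x⟫)
    (integrable_inner_pow_stdGaussian v 2) (r ^ 2)
  rw [integral_inner_sq_stdGaussian] at markov
  rw [le_div_iff₀' (by positivity)]
  simpa only [sq_le_sq, abs_of_pos hr] using markov

theorem measureReal_halfspace_symmDiff_halfspace_le {w u : E} (hu : 1 / 2 ≤ ‖u‖) (θ : ℝ) {r : ℝ}
    (hr : 0 < r) : (stdGaussian E).real (halfspace w θ ∆ halfspace u θ) ≤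
      2 * r + ‖w - u‖ ^ 2 / r ^ 2 := by
  refine (measureReal_mono (halfspace_symmDiff_halfspace_subset w u θ r)).trans
    ((measureReal_union_le _ _).trans
      (add_le_add ?_ (measureReal_le_abs_inner_stdGaussian (w - u) hr)))
  have hu_sq : (1 : ℝ) / 4 ≤ (‖u‖₊ ^ 2 : NNReal) := by
    push_cast
    nlinarith
  rw [← map_measureReal_apply (by fun_prop) measurableSet_Icc, map_inner_stdGaussian]
  calc (gaussianReal 0 (‖u‖₊ ^ 2)).real (Set.Icc (-θ - r) (-θ + r))
      ≤ volume.real (Set.Icc (-θ - r) (-θ + r)) :=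
        ENNReal.toReal_mono (by simp) (gaussianReal_le_volume 0 hu_sq _)
    _ = 2 * r := by
        rw [Real.volume_real_Icc_of_le (by linarith)]
        ring

theorem measureReal_halfspace_symmDiff_starProjection_le {V : Submodule ℝ E} {w : E}
    (hw : w = 0 ∨ ‖w‖ = 1) (θ : ℝ) {μ : ℝ} (hμ₀ : 0 < μ) (hμ₁ : μ ≤ 1)
    (hwV : ‖w - V.starProjection w‖ ≤ μ ^ 3 / 2) :
    (stdGaussian E).real (halfspace w θ ∆ halfspace (V.starProjection w) θ) ≤ 2 * μ ^ 2 := by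
  rcases hw with rfl | hw
  · simpa using by positivity
  have half_le_norm : 1 / 2 ≤ ‖V.starProjection w‖ := by
    have := norm_sub_norm_le w (V.starProjection w)
    have := pow_le_one₀ hμ₀.le hμ₁ (n := 3)
    linarith
  calc (stdGaussian E).real (halfspace w θ ∆ halfspace (V.starProjection w) θ)
      ≤ 2 * (μ ^ 2 / 2) + ‖w - V.starProjection w‖ ^ 2 / (μ ^ 2 / 2) ^ 2 :=
        measureReal_halfspace_symmDiff_halfspace_le half_le_norm θ (by positivity)
    _ ≤ 2 * (μ ^ 2 / 2) + (μ ^ 3 / 2) ^ 2 / (μ ^ 2 / 2) ^ 2 := by gcongr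
    _ = 2 * μ ^ 2 := by
        field_simp
        ring

theorem measureReal_biInter_halfspace_symmDiff_starProjection_le {V : Submodule ℝ E} {ι : Type*}
    {S : Finset ι} {w : ι → E} (hw : ∀ j ∈ S, w j = 0 ∨ ‖w j‖ = 1) (θ : ι → ℝ) {μ : ℝ}
    (hμ₀ : 0 < μ) (hμ₁ : μ ≤ 1) (hwV : ∀ j ∈ S, ‖w j - V.starProjection (w j)‖ ≤ μ ^ 3 / 2) :
    (stdGaussian E).real ((⋂ j ∈ S, halfspace (w j) (θ j)) ∆
      ⋂ j ∈ S, halfspace (V.starProjection (w j)) (θ j)) ≤ 2 * (S.card * μ ^ 2) :=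
  calc (stdGaussian E).real ((⋂ j ∈ S, halfspace (w j) (θ j)) ∆
        ⋂ j ∈ S, halfspace (V.starProjection (w j)) (θ j))
      ≤ ∑ j ∈ S, (stdGaussian E).real
          (halfspace (w j) (θ j) ∆ halfspace (V.starProjection (w j)) (θ j)) :=
        measureReal_biInter_symmDiff_biInter_le S _ _
    _ ≤ ∑ _j ∈ S, 2 * μ ^ 2 := Finset.sum_le_sum fun j hj ↦
        measureReal_halfspace_symmDiff_starProjection_le (hw j hj) (θ j) hμ₀ hμ₁ (hwV j hj)
    _ = 2 * (S.card * μ ^ 2) := by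
        rw [Finset.sum_const, nsmul_eq_mul]
        ring

end Rounding

section Approximation

variable {E : Type*} [NormedAddCommGroup E] [InnerProductSpace ℝ E] [FiniteDimensional ℝ E]
  [MeasurableSpace E] [BorelSpace E] {V : Submodule ℝ E} {μ : ℝ}

/-- In every direction orthogonal to `V`, the restriction of the standard Gaussian measure to `K`
has mean within `δ` of zero and second moment at least its mass minus `2 * δ`. The total mass is
not normalized. -/
def HasNearGaussianMoments (V : Submodule ℝ E) (K : Set E) (δ : ℝ) : Prop :=
  ∀ v ∈ Vᗮ, ‖v‖ = 1 → |∫ x in K, ⟪v, x⟫ ∂stdGaussian E| ≤ δ ∧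
    ∫ x in K, (1 - ⟪v, x⟫ ^ 2) ∂stdGaussian E ≤ 2 * δ

omit [FiniteDimensional ℝ E] [MeasurableSpace E] [BorelSpace E] in
theorem exists_mem_orthogonal_inner_eq_norm_sub_starProjection [V.HasOrthogonalProjection] {w : E}
    (hw : 0 < ‖w - V.starProjection w‖) :
    ∃ v ∈ Vᗮ, ‖v‖ = 1 ∧ ⟪v, w⟫ = ‖w - V.starProjection w‖ := by
  set u := w - V.starProjection w with hu
  have hu_mem : u ∈ Vᗮ := V.sub_starProjection_mem_orthogonal w
  refine ⟨‖u‖⁻¹ • u, Vᗮ.smul_mem _ hu_mem, ?_, ?_⟩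
  · rw [norm_smul, norm_inv, norm_norm, inv_mul_cancel₀ hw.ne']
  · have hw_eq : w = V.starProjection w + u := by rw [hu, add_sub_cancel]
    rw [hw_eq, real_inner_smul_left, inner_add_right,
      Submodule.inner_left_of_mem_orthogonal (V.starProjection_apply_mem w) hu_mem, zero_add,
      real_inner_self_eq_norm_sq]
    field_simp

theorem HasNearGaussianMoments.setIntegral_boundaryLayer_le_pow {K : Set E}
    (h_moments : HasNearGaussianMoments V K (μ ^ 22)) (hK : MeasurableSet K)
    (hK_convex : Convex ℝ K) (hμ₀ : 0 < μ) (hμ₁ : μ ≤ 1)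
    (hμK : μ ^ 22 ≤ (stdGaussian E).real K) {w : E} (hw : ‖w‖ = 1) {θ : ℝ}
    (hKw : K ⊆ halfspace w θ) (hwV : μ ^ 3 / 2 < ‖w - V.starProjection w‖) :
    ∫ x in K, boundaryLayer w θ (μ ^ 6 / 16) x ∂stdGaussian E ≤ 28 * μ ^ 16 := by
  set c := ‖w - V.starProjection w‖
  have hc : 0 < c := lt_trans (by positivity) hwV
  obtain ⟨v, hvV, hv, hvw⟩ := exists_mem_orthogonal_inner_eq_norm_sub_starProjection hc
  obtain ⟨h_mean, h_sq⟩ := h_moments v hvV hv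
  -- The width `μ ^ 6 / 16` is of the largest order that the tail cutoff `1 / μ ^ 3` and `c ≈ μ ^ 3`
  -- allow here.
  have layer_thin : μ ^ 6 / 16 * (1 + 1 / μ ^ 3) ≤ c / 4 := by
    have hμ_pow : μ ^ 6 ≤ μ ^ 3 := pow_le_pow_of_le_one hμ₀.le hμ₁ (by norm_num)
    calc μ ^ 6 / 16 * (1 + 1 / μ ^ 3) = (μ ^ 6 + μ ^ 3) / 16 := by field_simp
      _ ≤ c / 4 := by linarith
  have scaled_bound := setIntegral_boundaryLayer_le hK hK_convex hv hw hKw hvw hc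
    (by positivity) (by positivity) layer_thin (by positivity) hμK h_mean h_sq
  have mean_term_le : μ ^ 22 ≤ 4 * c ^ 2 * μ ^ 16 := by
    calc μ ^ 22 = 4 * (μ ^ 3 / 2) ^ 2 * μ ^ 16 := by ring
      _ ≤ 4 * c ^ 2 * μ ^ 16 := by gcongr
  have layer_term_le : c * (μ ^ 6 / 16) * (15 / (1 / μ ^ 3) ^ 5) ≤ 15 / 8 * c ^ 2 * μ ^ 16 := by
    calc c * (μ ^ 6 / 16) * (15 / (1 / μ ^ 3) ^ 5) = 15 / 8 * c * (μ ^ 3 / 2) * μ ^ 18 := by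
          field_simp
          ring
      _ ≤ 15 / 8 * c * c * μ ^ 16 := by
          gcongr ?_ * ?_
          · gcongr
          · exact pow_le_pow_of_le_one hμ₀.le hμ₁ (by norm_num)
      _ = 15 / 8 * c ^ 2 * μ ^ 16 := by ring
  refine le_of_mul_le_mul_left (scaled_bound.trans ?_) (by positivity : 0 < c ^ 2 / 2)
  have : 0 ≤ c ^ 2 * μ ^ 16 := by positivity
  linarith

theorem measureReal_sub_measureReal_inter_biInter_halfspace_le {K : Set E} (hK : MeasurableSet K)
    (hK_convex : Convex ℝ K) {ι : Type*} {S : Finset ι} {w : ι → E} {θ : ι → ℝ}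
    (h_moments : HasNearGaussianMoments V (K ∩ ⋂ j ∈ S, halfspace (w j) (θ j)) (μ ^ 22))
    (hμ₀ : 0 < μ) (hμ₁ : μ ≤ 1) (hw : ∀ j ∈ S, ‖w j‖ = 1)
    (hwV : ∀ j ∈ S, μ ^ 3 / 2 < ‖w j - V.starProjection (w j)‖)
    (hμK : S.card * μ ^ 2 ≤ (stdGaussian E).real (K ∩ ⋂ j ∈ S, halfspace (w j) (θ j))) :
    (stdGaussian E).real K - (stdGaussian E).real (K ∩ ⋂ j ∈ S, halfspace (w j) (θ j)) ≤
      114688 * μ ^ 2 := by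
  rcases S.eq_empty_or_nonempty with rfl | hS
  · simpa using by positivity
  set L := K ∩ ⋂ j ∈ S, halfspace (w j) (θ j)
  have : (0 : ℝ) < S.card := by exact_mod_cast hS.card_pos
  have one_le_card : (1 : ℝ) ≤ S.card := by exact_mod_cast hS.card_pos
  have hμL : μ ^ 22 ≤ (stdGaussian E).real L :=
    calc μ ^ 22 ≤ μ ^ 2 := pow_le_pow_of_le_one hμ₀.le hμ₁ (by norm_num)
      _ ≤ S.card * μ ^ 2 := le_mul_of_one_le_left (by positivity) one_le_card
      _ ≤ _ := hμK
  have hL_meas : MeasurableSet L := hK.inter (isClosed_biInter_halfspace S w θ).measurableSet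
  have hL_convex : Convex ℝ L := hK_convex.inter (convex_biInter_halfspace S w θ)
  have layer_le : ∀ j ∈ S,
      ∫ x in L, boundaryLayer (w j) (θ j) (μ ^ 6 / 16) x ∂stdGaussian E ≤ 28 * μ ^ 16 :=
    fun j hj ↦ h_moments.setIntegral_boundaryLayer_le_pow hL_meas hL_convex hμ₀ hμ₁ hμL (hw j hj)
      (Set.inter_subset_right.trans (Set.biInter_subset_of_mem hj)) (hwV j hj)
  have hs₂ : μ ^ 6 / 16 ≤ 2 := by linarith [pow_le_one₀ hμ₀.le hμ₁ (n := 6)]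
  have gap_nonneg : 0 ≤ (stdGaussian E).real K - (stdGaussian E).real L :=
    sub_nonneg.2 (measureReal_mono Set.inter_subset_left)
  refine le_of_mul_le_mul_right ?_ (by positivity : 0 < S.card * μ ^ 2)
  calc ((stdGaussian E).real K - (stdGaussian E).real L) * (S.card * μ ^ 2)
      ≤ ((stdGaussian E).real K - (stdGaussian E).real L) * (stdGaussian E).real L := by gcongr
    _ ≤ 16 / (μ ^ 6 / 16) ^ 2 *
          ∑ j ∈ S, ∫ x in L, boundaryLayer (w j) (θ j) (μ ^ 6 / 16) x ∂stdGaussian E :=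
        measureReal_sub_measureReal_inter_biInter_halfspace_mul_le hK hK_convex hw θ
          (by positivity) hs₂
    _ ≤ 16 / (μ ^ 6 / 16) ^ 2 * ∑ _j ∈ S, 28 * μ ^ 16 := by
        gcongr with j hj
        exact layer_le j hj
    _ = 114688 * μ ^ 2 * (S.card * μ ^ 2) := by
        rw [Finset.sum_const, nsmul_eq_mul]
        field_simp
        ring

theorem exists_finset_measureReal_symmDiff_biInter_halfspace_le {ι : Type*} [Fintype ι]
    {w : ι → E} {θ : ι → ℝ} (hw : ∀ j, w j = 0 ∨ ‖w j‖ = 1)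
    (h_moments : HasNearGaussianMoments V (⋂ j, halfspace (w j) (θ j)) (μ ^ 22))
    (hμ₀ : 0 < μ) (hμ₁ : μ ≤ 1)
    (hμK : Fintype.card ι * μ ^ 2 ≤ (stdGaussian E).real (⋂ j, halfspace (w j) (θ j))) :
    ∃ S : Finset ι, (stdGaussian E).real ((⋂ j, halfspace (w j) (θ j)) ∆
      ⋂ j ∈ S, halfspace (V.starProjection (w j)) (θ j)) ≤
        114688 * μ ^ 2 + 2 * (Fintype.card ι * μ ^ 2) := by
  classical
  let near : Finset ι := {j | ‖w j - V.starProjection (w j)‖ ≤ μ ^ 3 / 2}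
  let K₀ := ⋂ j ∈ near, halfspace (w j) (θ j)
  let K₁ := ⋂ j ∈ near, halfspace (V.starProjection (w j)) (θ j)
  have far_iff (j : ι) : j ∈ nearᶜ ↔ μ ^ 3 / 2 < ‖w j - V.starProjection (w j)‖ := by
    simp [near]
  have far_unit : ∀ j ∈ nearᶜ, ‖w j‖ = 1 := fun j hj ↦ (hw j).resolve_left fun hj₀ ↦ by
    have := (far_iff j).1 hj
    rw [hj₀, map_zero, sub_zero, norm_zero] at this
    exact this.not_ge (by positivity)
  have K_eq : ⋂ j, halfspace (w j) (θ j) = K₀ ∩ ⋂ j ∈ nearᶜ, halfspace (w j) (θ j) := by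
    ext x
    simp only [K₀, Set.mem_inter_iff, Set.mem_iInter, Finset.mem_compl]
    grind
  have K₀_meas : MeasurableSet K₀ := (isClosed_biInter_halfspace near w θ).measurableSet
  have far_le : (stdGaussian E).real ((⋂ j, halfspace (w j) (θ j)) ∆ K₀) ≤ 114688 * μ ^ 2 := by
    have card_le : (nearᶜ.card : ℝ) * μ ^ 2 ≤ (stdGaussian E).real (⋂ j, halfspace (w j) (θ j)) :=
      hμK.trans' (by gcongr; exact nearᶜ.card_le_univ)
    rw [K_eq] at card_le h_moments ⊢
    rw [symmDiff_of_le Set.inter_subset_left, measureReal_sdiff Set.inter_subset_left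
      (K₀_meas.inter (isClosed_biInter_halfspace nearᶜ w θ).measurableSet)]
    exact measureReal_sub_measureReal_inter_biInter_halfspace_le K₀_meas
      (convex_biInter_halfspace near w θ) h_moments hμ₀ hμ₁ far_unit
      (fun j ↦ (far_iff j).1) card_le
  have near_le : (stdGaussian E).real (K₀ ∆ K₁) ≤ 2 * (Fintype.card ι * μ ^ 2) :=
    calc (stdGaussian E).real (K₀ ∆ K₁) ≤ 2 * (near.card * μ ^ 2) :=
          measureReal_biInter_halfspace_symmDiff_starProjection_le (fun j _ ↦ hw j) θ hμ₀ hμ₁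
            fun j hj ↦ (Finset.mem_filter.1 hj).2
      _ ≤ 2 * (Fintype.card ι * μ ^ 2) := by
          gcongr
          exact near.card_le_univ
  exact ⟨near, (measureReal_symmDiff_le _).trans (add_le_add far_le near_le)⟩

end Approximation

section NormalizedQuadratic

theorem integral_sq_sub_one_sq_gaussianReal : ∫ t, (t ^ 2 - 1) ^ 2 ∂gaussianReal 0 1 = 2 := by
  have expand (t : ℝ) : (t ^ 2 - 1) ^ 2 = t ^ 4 - 2 * t ^ 2 + 1 := by ring
  have integrable_pow_four := integrable_pow_gaussianReal 4 0 1
  have integrable_two_mul_sq := (integrable_pow_gaussianReal 2 0 1).const_mul 2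
  simp only [expand]
  rw [integral_add (by exact integrable_pow_four.sub integrable_two_mul_sq) (integrable_const 1),
    integral_sub integrable_pow_four integrable_two_mul_sq, integral_const_mul,
    integral_pow_four_gaussianReal, integral_sq_gaussianReal, integral_const, probReal_univ]
  norm_num

theorem isNormalizedMeanZeroQuadratic_X : IsNormalizedMeanZeroQuadratic Polynomial.X :=
  ⟨Polynomial.natDegree_X_le.trans one_le_two, by simp,
    by simpa using integral_sq_gaussianReal⟩

theorem isNormalizedMeanZeroQuadratic_inv_sqrt_two_mul_sq_sub_one :
    IsNormalizedMeanZeroQuadratic (Polynomial.C (√2)⁻¹ * (Polynomial.X ^ 2 - 1)) := by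
  refine ⟨(Polynomial.natDegree_C_mul_le _ _).trans (by compute_degree), ?_, ?_⟩
  · simp only [Polynomial.eval_mul, Polynomial.eval_C, Polynomial.eval_sub, Polynomial.eval_pow,
      Polynomial.eval_X, Polynomial.eval_one]
    rw [integral_const_mul,
      integral_sub (integrable_pow_gaussianReal 2 0 1) (integrable_const 1),
      integral_sq_gaussianReal, integral_const, probReal_univ, one_smul, sub_self, mul_zero]
  · simp only [Polynomial.eval_mul, Polynomial.eval_C, Polynomial.eval_sub, Polynomial.eval_pow,
      Polynomial.eval_X, Polynomial.eval_one, mul_pow]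
    rw [integral_const_mul, integral_sq_sub_one_sq_gaussianReal, inv_pow, Real.sq_sqrt zero_le_two,
      inv_mul_cancel₀ two_ne_zero]

theorem integral_indicator_one_mul {Ω : Type*} [MeasurableSpace Ω] {μ : Measure Ω} {A : Set Ω}
    (hA : MeasurableSet A) (f : Ω → ℝ) : ∫ x, A.indicator 1 x * f x ∂μ = ∫ x in A, f x ∂μ := by
  rw [← integral_indicator hA]
  simp only [← Set.indicator_mul_left, Pi.one_apply, one_mul]

variable {E : Type*} [NormedAddCommGroup E] [InnerProductSpace ℝ E] [FiniteDimensional ℝ E]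
  [MeasurableSpace E]

theorem hasNearGaussianMoments_of_forall_abs_integral_lt {V : Submodule ℝ E} {K : Set E}
    (hK : MeasurableSet K) {δ : ℝ}
    (h : ∀ v ∈ Vᗮ, ‖v‖ = 1 → ∀ p : Polynomial ℝ, IsNormalizedMeanZeroQuadratic p →
      |∫ x, K.indicator 1 x * p.eval ⟪v, x⟫ ∂stdGaussian E| < δ) :
    HasNearGaussianMoments V K δ := by
  intro v hvV hv
  simp only [integral_indicator_one_mul hK] at h
  have h_linear := h v hvV hv _ isNormalizedMeanZeroQuadratic_X
  have h_quadratic := h v hvV hv _ isNormalizedMeanZeroQuadratic_inv_sqrt_two_mul_sq_sub_one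
  simp only [Polynomial.eval_mul, Polynomial.eval_C, Polynomial.eval_sub, Polynomial.eval_pow,
    Polynomial.eval_X, Polynomial.eval_one] at h_linear h_quadratic
  refine ⟨h_linear.le, ?_⟩
  rw [integral_const_mul, abs_mul, abs_of_pos (by positivity), inv_mul_lt_iff₀ (by positivity)]
    at h_quadratic
  have hδ : 0 ≤ δ := (abs_nonneg _).trans h_linear.le
  calc ∫ x in K, (1 - ⟪v, x⟫ ^ 2) ∂stdGaussian E
      = -∫ x in K, (⟪v, x⟫ ^ 2 - 1) ∂stdGaussian E := by
        rw [← integral_neg]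
        simp only [neg_sub]
    _ ≤ |∫ x in K, (⟪v, x⟫ ^ 2 - 1) ∂stdGaussian E| := neg_le_abs _
    _ ≤ √2 * δ := h_quadratic.le
    _ ≤ 2 * δ := by
        gcongr
        exact Real.sqrt_le_iff.2 (by norm_num)

end NormalizedQuadratic

section LinearThreshold

variable {n k : ℕ}

theorem halfspace_smul_mul {E : Type*} [NormedAddCommGroup E] [InnerProductSpace ℝ E] (w : E)
    (θ : ℝ) {c : ℝ} (hc : 0 < c) : halfspace (c • w) (c * θ) = halfspace w θ := by
  ext x
  rw [halfspace, halfspace, Set.mem_ofPred_eq, Set.mem_ofPred_eq, real_inner_smul_left, ← mul_add,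
    mul_nonneg_iff_of_pos_left hc]

theorem IsLTF.exists_halfspace {h : EuclideanSpace ℝ (Fin n) → ℝ} (hh : IsLTF h) :
    ∃ w θ, (w = 0 ∨ ‖w‖ = 1) ∧ ∀ x, h x = 1 ↔ x ∈ halfspace w θ := by
  obtain ⟨w, θ, h_eq⟩ := hh
  have h_iff (x) : h x = 1 ↔ x ∈ halfspace w θ := by
    rw [h_eq, halfspace, Set.mem_ofPred_eq]
    split_ifs with hx <;> norm_num [hx]
  rcases eq_or_ne w 0 with hw | hw
  · exact ⟨w, θ, .inl hw, h_iff⟩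
  · refine ⟨‖w‖⁻¹ • w, ‖w‖⁻¹ * θ, .inr (norm_smul_inv_norm hw), fun x ↦ ?_⟩
    rw [halfspace_smul_mul w θ (inv_pos.2 (norm_pos_iff.2 hw)), h_iff]

open Classical in
theorem IsIntersectionOfLTFs.exists_eq_indicator {f : EuclideanSpace ℝ (Fin n) → ℝ}
    (hf : IsIntersectionOfLTFs k f) :
    ∃ (w : Fin k → EuclideanSpace ℝ (Fin n)) (θ : Fin k → ℝ), (∀ j, w j = 0 ∨ ‖w j‖ = 1) ∧
      f = (⋂ j, halfspace (w j) (θ j)).indicator 1 := by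
  obtain ⟨h, hh, f_eq⟩ := hf
  choose w θ hw h_iff using fun j ↦ (hh j).exists_halfspace
  refine ⟨w, θ, hw, funext fun x ↦ ?_⟩
  rw [f_eq, Set.indicator_apply]
  simp only [h_iff, Set.mem_iInter, Pi.one_apply]

open Classical in
theorem isIntersectionOfLTFs_indicator_iInter_halfspace (w : Fin k → EuclideanSpace ℝ (Fin n))
    (θ : Fin k → ℝ) : IsIntersectionOfLTFs k ((⋂ j, halfspace (w j) (θ j)).indicator 1) := by
  refine ⟨fun j x ↦ if 0 ≤ ⟪w j, x⟫ + θ j then 1 else -1, fun j ↦ ⟨w j, θ j, fun x ↦ rfl⟩,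
    fun x ↦ ?_⟩
  have ltf_eq_one_iff (j : Fin k) :
      (if 0 ≤ ⟪w j, x⟫ + θ j then (1 : ℝ) else -1) = 1 ↔ x ∈ halfspace (w j) (θ j) := by
    rw [halfspace, Set.mem_ofPred_eq]
    split_ifs with hx <;> norm_num [hx]
  simp only [ltf_eq_one_iff, Set.indicator_apply, Set.mem_iInter, Pi.one_apply]

theorem isIntersectionOfLTFs_indicator_biInter_halfspace {ι : Type*} (S : Finset ι)
    (w : ι → EuclideanSpace ℝ (Fin n)) (θ : ι → ℝ) :
    IsIntersectionOfLTFs S.card ((⋂ j ∈ S, halfspace (w j) (θ j)).indicator 1) := by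
  have reindex : ⋂ j ∈ S, halfspace (w j) (θ j) =
      ⋂ i, halfspace (w (S.equivFin.symm i)) (θ (S.equivFin.symm i)) := by
    rw [S.equivFin.symm.surjective.iInter_comp fun j : S ↦ halfspace (w j) (θ j)]
    exact Set.biInter_eq_iInter (· ∈ S) fun j _ ↦ halfspace (w j) (θ j)
  rw [reindex]
  exact isIntersectionOfLTFs_indicator_iInter_halfspace _ _

theorem isIntersectionOfLTFs_zero (hk : 0 < k) :
    IsIntersectionOfLTFs k (0 : EuclideanSpace ℝ (Fin n) → ℝ) := by
  have iInter_eq : ⋂ _j : Fin k, halfspace (0 : EuclideanSpace ℝ (Fin n)) (-1) = ∅ := by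
    have : Nonempty (Fin k) := ⟨⟨0, hk⟩⟩
    have not_one_le_zero : ¬(1 : ℝ) ≤ 0 := by norm_num
    simp [halfspace, Set.iInter_const, not_one_le_zero]
  have := isIntersectionOfLTFs_indicator_iInter_halfspace
    (fun _ : Fin k ↦ (0 : EuclideanSpace ℝ (Fin n))) fun _ ↦ -1
  rwa [iInter_eq, Set.indicator_empty'] at this

theorem integral_abs_indicator_one_sub_indicator_one {Ω : Type*} [MeasurableSpace Ω]
    {μ : Measure Ω} {A B : Set Ω} (hA : MeasurableSet A) (hB : MeasurableSet B) :
    ∫ x, |A.indicator 1 x - B.indicator 1 x| ∂μ = μ.real (A ∆ B) := by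
  rw [← integral_indicator_one (hA.symmDiff hB)]
  congr with x
  rw [← Set.apply_indicator_symmDiff abs_neg]
  exact abs_of_nonneg (Set.indicator_nonneg (fun _ _ ↦ zero_le_one) x)

theorem exists_isIntersectionOfLTFs_integral_abs_indicator_sub_le
    {V : Submodule ℝ (EuclideanSpace ℝ (Fin n))} {w : Fin k → EuclideanSpace ℝ (Fin n)}
    {θ : Fin k → ℝ} (hw : ∀ j, w j = 0 ∨ ‖w j‖ = 1) {μ : ℝ} (hμ₀ : 0 < μ)
    (h_moments : HasNearGaussianMoments V (⋂ j, halfspace (w j) (θ j)) (μ ^ 22)) :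
    ∃ (k' : ℕ) (g : EuclideanSpace ℝ (Fin n) → ℝ), k' ≤ k ∧ IsIntersectionOfLTFs k' g ∧
      (∀ x, g x = g (V.starProjection x)) ∧
      ∫ x, |(⋂ j, halfspace (w j) (θ j)).indicator 1 x - g x| ∂stdGaussian _ ≤
        114690 * μ ^ 2 * k := by
  rcases k.eq_zero_or_pos with rfl | hk
  · exact ⟨0, _, le_rfl, isIntersectionOfLTFs_indicator_iInter_halfspace w θ, by simp, by simp⟩
  have one_le_k : (1 : ℝ) ≤ k := by exact_mod_cast hk
  set K := ⋂ j, halfspace (w j) (θ j)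
  have hK : MeasurableSet K := .iInter fun j ↦ (isClosed_halfspace (w j) (θ j)).measurableSet
  rcases le_or_gt ((stdGaussian (EuclideanSpace ℝ (Fin n))).real K) (k * μ ^ 2) with hKμ | hKμ
  · refine ⟨k, 0, le_rfl, isIntersectionOfLTFs_zero hk, fun x ↦ rfl, ?_⟩
    rw [← Set.indicator_empty' (1 : EuclideanSpace ℝ (Fin n) → ℝ),
      integral_abs_indicator_one_sub_indicator_one hK .empty, ← Set.bot_eq_empty, symmDiff_bot]
    nlinarith [sq_nonneg μ]
  · have hμ₁ : μ ≤ 1 := by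
      have : k * μ ^ 2 ≤ 1 := hKμ.le.trans measureReal_le_one
      nlinarith [sq_nonneg μ]
    obtain ⟨S, hS⟩ := exists_finset_measureReal_symmDiff_biInter_halfspace_le hw h_moments hμ₀ hμ₁
      (by simpa only [Fintype.card_fin] using hKμ.le)
    set L := ⋂ j ∈ S, halfspace (V.starProjection (w j)) (θ j)
    have hL : MeasurableSet L := (isClosed_biInter_halfspace S _ θ).measurableSet
    have mem_L_iff (x) : V.starProjection x ∈ L ↔ x ∈ L := by
      simp only [L, Set.mem_iInter,
        starProjection_mem_halfspace_iff (V.starProjection_apply_mem _)]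
    refine ⟨S.card, L.indicator 1, by simpa using S.card_le_univ,
      isIntersectionOfLTFs_indicator_biInter_halfspace S _ θ, fun x ↦ ?_, ?_⟩
    · classical simp only [Set.indicator_apply, mem_L_iff, Pi.one_apply]
    · rw [integral_abs_indicator_one_sub_indicator_one hK hL]
      refine hS.trans ?_
      rw [Fintype.card_fin]
      nlinarith [sq_nonneg μ]

end LinearThreshold

theorem rpow_mul_natCast_le {k : ℕ} {δ : ℝ} (hδ : 0 < δ) (hδk : δ ≤ k / 2) :
    δ ^ ((1 : ℝ) / 11) * k ≤ 2 * δ ^ ((1 : ℝ) / 11) * (k : ℝ) ^ ((15 : ℝ) / 11) *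
      Real.log (k / δ) ^ ((2 : ℝ) / 11) := by
  have one_le_k : (1 : ℝ) ≤ k := by
    rw [Nat.one_le_cast, Nat.one_le_iff_ne_zero]
    rintro rfl
    norm_num at hδk
    linarith
  have half_le_log : 1 / 2 ≤ Real.log (k / δ) :=
    calc (1 : ℝ) / 2 ≤ Real.log 2 := by linarith [Real.log_two_gt_d9]
      _ ≤ Real.log (k / δ) := Real.log_le_log two_pos ((le_div_iff₀ hδ).2 (by linarith))
  have half_le_log_rpow : 1 / 2 ≤ Real.log (k / δ) ^ ((2 : ℝ) / 11) :=
    calc (1 : ℝ) / 2 ≤ (1 / 2) ^ ((2 : ℝ) / 11) :=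
          Real.self_le_rpow_of_le_one (by norm_num) (by norm_num) (by norm_num)
      _ ≤ Real.log (k / δ) ^ ((2 : ℝ) / 11) := by gcongr
  calc δ ^ ((1 : ℝ) / 11) * k = 2 * δ ^ ((1 : ℝ) / 11) * k * (1 / 2) := by ring
    _ ≤ 2 * δ ^ ((1 : ℝ) / 11) * (k : ℝ) ^ ((15 : ℝ) / 11) *
          Real.log (k / δ) ^ ((2 : ℝ) / 11) := by
        gcongr
        exact Real.self_le_rpow_of_one_le one_le_k (by norm_num)

theorem mainTheorem10_general :
    ∃ C : ℝ, 0 < C ∧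
      ∀ (n k : ℕ) (δ : ℝ) (f : EuclideanSpace ℝ (Fin n) → ℝ)
        (V : Submodule ℝ (EuclideanSpace ℝ (Fin n))),
        0 < δ →
        IsIntersectionOfLTFs k f →
        (∀ v ∈ Vᗮ, ‖v‖ = 1 → ∀ p : Polynomial ℝ, IsNormalizedMeanZeroQuadratic p →
          |∫ x, f x * p.eval (inner ℝ v x) ∂(stdGaussian (EuclideanSpace ℝ (Fin n)))| < δ) →
        ∃ (k' : ℕ) (g : EuclideanSpace ℝ (Fin n) → ℝ),
          k' ≤ k ∧ IsIntersectionOfLTFs k' g ∧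
          (∀ x, g x = g (V.starProjection x)) ∧
          ∫ x, |f x - g x| ∂(stdGaussian (EuclideanSpace ℝ (Fin n))) ≤
            C * δ ^ ((1 : ℝ) / 11) * k := by
  refine ⟨114690, by norm_num, fun n k δ f V hδ hf h_moments ↦ ?_⟩
  have pow_rpow (m : ℕ) : (δ ^ ((1 : ℝ) / 22)) ^ m = δ ^ ((m : ℝ) / 22) := by
    rw [← Real.rpow_mul_natCast hδ.le, div_mul_eq_mul_div, one_mul]
  have sq_eq : (δ ^ ((1 : ℝ) / 22)) ^ 2 = δ ^ ((1 : ℝ) / 11) := by norm_num [pow_rpow]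
  have pow_eq : (δ ^ ((1 : ℝ) / 22)) ^ 22 = δ := by norm_num [pow_rpow]
  obtain ⟨w, θ, hw, rfl⟩ := hf.exists_eq_indicator
  rw [← sq_eq]
  exact exists_isIntersectionOfLTFs_integral_abs_indicator_sub_le hw (by positivity)
    (pow_eq.symm ▸ hasNearGaussianMoments_of_forall_abs_integral_lt
      (.iInter fun j ↦ (isClosed_halfspace (w j) (θ j)).measurableSet) h_moments)

theorem mainTheorem10 :
    ∃ C : ℝ, 0 < C ∧
      ∀ (n k : ℕ) (δ : ℝ) (f : EuclideanSpace ℝ (Fin n) → ℝ)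
        (V : Submodule ℝ (EuclideanSpace ℝ (Fin n))),
        0 < δ → δ ≤ (k : ℝ) / 2 →
        IsIntersectionOfLTFs k f →
        (∀ v ∈ Vᗮ, ‖v‖ = 1 → ∀ p : Polynomial ℝ, IsNormalizedMeanZeroQuadratic p →
          |∫ x, f x * p.eval (inner ℝ v x) ∂(stdGaussian (EuclideanSpace ℝ (Fin n)))| < δ) →
        ∃ (k' : ℕ) (g : EuclideanSpace ℝ (Fin n) → ℝ),
          k' ≤ k ∧ IsIntersectionOfLTFs k' g ∧
          (∀ x, g x = g (V.starProjection x)) ∧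
          ∫ x, |f x - g x| ∂(stdGaussian (EuclideanSpace ℝ (Fin n))) ≤
            C * δ ^ ((1 : ℝ) / 11) * (k : ℝ) ^ ((15 : ℝ) / 11)
              * Real.log ((k : ℝ) / δ) ^ ((2 : ℝ) / 11) := by
  obtain ⟨C, hC, h_approx⟩ := mainTheorem10_general
  refine ⟨C * 2, by positivity, fun n k δ f V hδ hδk hf h_moments ↦ ?_⟩
  obtain ⟨k', g, hk', hg, hgV, h_dist⟩ := h_approx n k δ f V hδ hf h_moments
  refine ⟨k', g, hk', hg, hgV, h_dist.trans ?_⟩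
  simpa only [mul_assoc] using mul_le_mul_of_nonneg_left (rpow_mul_natCast_le hδ hδk) hC.le
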